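/- Let $\mathcal A$ be a finite set and let $\mathcal P$ be the simplex of probability distributions on $\mathcal A$, with entropy $H[\mathbf p]=-\sum_\alpha p_\alpha\log p_\alpha$ (where $0\log 0=0$). An architecture is a real $D\times|\mathcal A|$ matrix $\mathbf R$ with linearly independent rows whose row space contains the normalization row $(1,\dots,1)$. For $\mathbf f\in\mathcal P$ put $[\mathbf f]_{\mathbf R}=\{\mathbf p\in\mathcal P : \mathbf R\mathbf p=\mathbf R\mathbf f\}$; the MaxEnt distribution of $[\mathbf f]_{\mathbf R}$ is the unique maximizer of $H$ on this set. Let $\widehat{\mathbf R}$ and $\widehat{\mathbf R}'$ be architectures with $\widehat D$ and $\widehat D'$ rows such that $\widehat{\mathbf R}'$ implies $\widehat{\mathbf R}$, i.e. $\widehat{\mathbf R}=\mathbf T\widehat{\mathbf R}'$ for some matrix $\mathbf T$. For $\mathbf f\in\mathcal P$ let $\hat{\mathbf p}$ and $\hat{\mathbf p}'$ be the MaxEnt distributions of $[\mathbf f]_{\widehat{\mathbf R}}$ and $[\mathbf f]_{\widehat{\mathbf R}'}$, and let $\hat\delta(\mathbf f)=H[\hat{\mathbf p}]-H[\hat{\mathbf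 p}']$. (i) For every dataset of sample size $N\ge 1$ with empirical distribution $\mathbf f$, the multinomial likelihoods $\mathrm{mult}(N\mathbf f;\mathbf q)=\frac{N!}{\prod_\alpha (Nf_\alpha)!}\prod_\alpha q_\alpha^{Nf_\alpha}$ at $\mathbf q=\hat{\mathbf p}$ and $\mathbf q=\hat{\mathbf p}'$ are positive, and $$\log\frac{\mathrm{mult}(N\mathbf f;\hat{\mathbf p}')}{\mathrm{mult}(N\mathbf f;\hat{\mathbf p})}=N\,\hat\delta(\mathbf f)$$ exactly (hence in particular to leading order in $N$). (ii) Suppose in addition that $\widehat D<\widehat D'$ and that $\ker\widehat{\mathbf R}$ is spanned by integer vectors (equivalently, the constraints of $\widehat{\mathbf R}$ can be written with rational coefficients). Let $\mathbf f$ be the empirical distribution of some nonempty dataset, such that no microstate is forced to have probability zero: for each $\alpha$ there is $\mathbf p\in[\mathbf f]_{\widehat{\mathbf R}}$ with $p_\alpha>0$. For a sample size $N$ let $\mathbf P_N$ be the probability distribution on the empirical distributions $\mathbf p\in[\mathbf f]_{\widehat{\mathbf R}}$ of datasets of size $N$ (those with $N\mathbf p$ integer) that gives $\mathbf p$ probability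 proportional to $e^{N H[\mathbf p]}$. Let $F_k$ be the cumulative distribution function of the $\chi^2_k$ law. Then rejecting the simpler model $\hat{\mathbf p}$ in favor of $\hat{\mathbf p}'$ whenever $1-F_{\widehat D'-\widehat D}(2N\hat\delta)<\alpha$ is a test of asymptotic significance level $\alpha$: for every $\alpha\in(0,1)$, $$\mathbf P_N\left(\left\{\mathbf p : 1-F_{\widehat D'-\widehat D}\big(2N\hat\delta(\mathbf p)\big)<\alpha\right\}\right)\longrightarrow\alpha$$ as $N\to\infty$ through those sample sizes for which such a $\mathbf p$ exists. -/

import Mathlib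

open Real Set Filter Topology MeasureTheory ProbabilityTheory Matrix

namespace MaxEntLRT

noncomputable section

/-- Shannon entropy `H[p] = - ∑ p_α log p_α` (with `0 log 0 = 0`). -/
def entropy {A : Type*} [Fintype A] (p : A → ℝ) : ℝ := ∑ a, negMulLog (p a)

/-- An architecture matrix: its rows (the constraints) are linearly independent, and the
normalization condition `∑ p_α = 1` is among the constraints they span. -/
structure IsArchitecture {A : Type*} {D : ℕ} (R : Matrix (Fin D) A ℝ) : Prop where
  linearIndependent_rows : LinearIndependent ℝ R.row
  normalization : (fun _ => 1 : A → ℝ) ∈ Submodule.span ℝ (Set.range R.row)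

/-- The architecture `R'` implies the architecture `R`: the constraints of `R` are linear
combinations of those of `R'`. -/
def Implies {A : Type*} {D D' : ℕ} (R' : Matrix (Fin D') A ℝ) (R : Matrix (Fin D) A ℝ) : Prop :=
  ∃ T : Matrix (Fin D) (Fin D') ℝ, R = T * R'

/-- The equivalence class `[f]_R`: the distributions with the same `R`-moments as `f`. -/
def eqClass {A : Type*} [Fintype A] {D : ℕ} (R : Matrix (Fin D) A ℝ) (f : A → ℝ) :
    Set (A → ℝ) :=
  {p | p ∈ stdSimplex ℝ A ∧ R *ᵥ p = R *ᵥ f}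

/-- `p` maximizes the entropy over `[f]_R`. -/
def IsMaxEnt {A : Type*} [Fintype A] {D : ℕ} (R : Matrix (Fin D) A ℝ) (f p : A → ℝ) : Prop :=
  p ∈ eqClass R f ∧ IsMaxOn entropy (eqClass R f) p

/-- The MaxEnt distribution of `[f]_R`; it exists and is unique for every distribution `f`,
see `isMaxEnt_maxEnt` and `IsMaxEnt.eq_maxEnt`. -/
def maxEnt {A : Type*} [Fintype A] {D : ℕ} (R : Matrix (Fin D) A ℝ) (f : A → ℝ) : A → ℝ :=
  Classical.epsilon (IsMaxEnt R f)

theorem isMaxEnt_maxEnt {A : Type*} [Fintype A] {D : ℕ} (R : Matrix (Fin D) A ℝ) {f : A → ℝ}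
    (hf : f ∈ stdSimplex ℝ A) : IsMaxEnt R f (maxEnt R f) := by
  apply Classical.epsilon_spec (p := IsMaxEnt R f)
  have hclosed : IsClosed {p : A → ℝ | R *ᵥ p = R *ᵥ f} :=
    isClosed_eq (Continuous.matrix_mulVec continuous_const continuous_id) continuous_const
  have hc : IsCompact (eqClass R f) := (isCompact_stdSimplex ℝ A).inter_right hclosed
  have hcont : Continuous (entropy : (A → ℝ) → ℝ) := by
    unfold entropy
    exact continuous_finsetSum _ fun a _ => continuous_negMulLog.comp (continuous_apply a)
  obtain ⟨p, hp, hm⟩ := hc.exists_isMaxOn ⟨f, hf, rfl⟩ hcont.continuousOn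
  exact ⟨p, hp, hm⟩

theorem IsMaxEnt.eq {A : Type*} [Fintype A] {D : ℕ} {R : Matrix (Fin D) A ℝ} {f p q : A → ℝ}
    (hp : IsMaxEnt R f p) (hq : IsMaxEnt R f q) : p = q := by
  by_contra hne
  obtain ⟨a, ha⟩ := Function.ne_iff.mp hne
  have hmem : (1 / 2 : ℝ) • p + (1 / 2 : ℝ) • q ∈ eqClass R f := by
    refine ⟨convex_stdSimplex ℝ A hp.1.1 hq.1.1 (by norm_num) (by norm_num) (by norm_num), ?_⟩
    rw [mulVec_add, mulVec_smul, mulVec_smul, hp.1.2, hq.1.2, ← add_smul]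
    norm_num
  have hlt : (1 / 2 : ℝ) * entropy p + (1 / 2 : ℝ) * entropy q
      < entropy ((1 / 2 : ℝ) • p + (1 / 2 : ℝ) • q) := by
    unfold entropy
    rw [Finset.mul_sum, Finset.mul_sum, ← Finset.sum_add_distrib]
    refine Finset.sum_lt_sum (fun b _ => ?_) ⟨a, Finset.mem_univ a, ?_⟩
    · exact concaveOn_negMulLog.2 (hp.1.1.1 b) (hq.1.1.1 b) (by norm_num) (by norm_num)
        (by norm_num)
    · exact strictConcaveOn_negMulLog.2 (hp.1.1.1 a) (hq.1.1.1 a) ha (by norm_num) (by norm_num)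
        (by norm_num)
  have h1 := hp.2 hmem
  have h2 := hq.2 hmem
  simp only [Set.mem_ofPred_eq] at h1 h2
  linarith

theorem IsMaxEnt.eq_maxEnt {A : Type*} [Fintype A] {D : ℕ} {R : Matrix (Fin D) A ℝ}
    {f p : A → ℝ} (hf : f ∈ stdSimplex ℝ A) (hp : IsMaxEnt R f p) : p = maxEnt R f :=
  hp.eq (isMaxEnt_maxEnt R hf)

/-- A dataset enters through its counts `n_α`; its sample size is `N = ∑ n_α`, and its empirical
distribution is `f_α = n_α / N`. -/
def empirical {A : Type*} [Fintype A] (n : A → ℕ) : A → ℝ :=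
  fun a => (n a : ℝ) / ((∑ b, n b : ℕ) : ℝ)

/-- The multinomial probability `mult(n; q) = N! / ∏ n_α! * ∏ q_α ^ n_α` of the counts `n`. -/
def mult {A : Type*} [Fintype A] (n : A → ℕ) (q : A → ℝ) : ℝ :=
  (Nat.multinomial Finset.univ n : ℝ) * ∏ a, q a ^ n a

/-- The entropy difference `H[p̂] - H[p̂']` of the MaxEnt distributions of the models `R` and `R'`
on data with empirical distribution `f`. -/
def entropyGap {A : Type*} [Fintype A] {D D' : ℕ} (R : Matrix (Fin D) A ℝ)
    (R' : Matrix (Fin D') A ℝ) (f : A → ℝ) : ℝ :=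
  entropy (maxEnt R f) - entropy (maxEnt R' f)

/-- The chi-squared law with `k` degrees of freedom: the law of the sum of the squares of `k`
independent standard Gaussian variables. -/
def chiSquared (k : ℕ) : Measure ℝ :=
  (Measure.pi fun _ : Fin k => gaussianReal 0 1).map fun x => ∑ i, x i ^ 2

/-- The simpler model `R` is rejected in favor of `R'` at level `s` by data with sample size `N`
and empirical distribution `f`: the p-value `1 - F_{D'-D}(2 N (H[p̂] - H[p̂']))` is below `s`. -/
def Rejected {A : Type*} [Fintype A] {D D' : ℕ} (R : Matrix (Fin D) A ℝ)
    (R' : Matrix (Fin D') A ℝ) (s : ℝ) (N : ℕ) (f : A → ℝ) : Prop :=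
  1 - cdf (chiSquared (D' - D)) (2 * N * entropyGap R R' f) < s

open Classical in
/-- The counts of all datasets of sample size `N` whose empirical distribution lies in `[f]_R`. -/
def datasets {A : Type*} [Fintype A] {D : ℕ} (R : Matrix (Fin D) A ℝ) (f : A → ℝ) (N : ℕ) :
    Finset (A → ℕ) :=
  {n ∈ Finset.piAntidiag Finset.univ N | empirical n ∈ eqClass R f}

open Classical in
/-- The probability of the event `E` under the distribution over the empirical distributions `p`
of sample size `N` in `[f]_R`, in which `p` has probability proportional to `exp (N H[p])`. -/
def classProb {A : Type*} [Fintype A] {D : ℕ} (R : Matrix (Fin D) A ℝ) (f : A → ℝ) (N : ℕ)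
    (E : (A → ℝ) → Prop) : ℝ :=
  (∑ n ∈ datasets R f N with E (empirical n), exp (N * entropy (empirical n))) /
    ∑ n ∈ datasets R f N, exp (N * entropy (empirical n))

/-- The kernel of `R` is spanned by integer vectors; equivalently, the linear system of `R` can be
written with rational coefficients. -/
def HasIntegralKernel {A : Type*} [Fintype A] {D : ℕ} (R : Matrix (Fin D) A ℝ) : Prop :=
  ∀ v : A → ℝ, R *ᵥ v = 0 →
    v ∈ Submodule.span ℝ {w : A → ℝ | R *ᵥ w = 0 ∧ ∃ z : A → ℤ, w = fun a => (z a : ℝ)}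

end

end MaxEntLRT

/-! Part (i) rests on the first-order condition for the entropy maximizer p of a class: the cross
entropy -∑ q_α log p_α equals H[p] for every q in the class (`IsMaxEnt.sum_mul_log`). The condition
is an equality because p vanishes only where the whole class vanishes
(`IsMaxEnt.eq_zero_of_eq_zero`), so p can be moved both towards q and away from it. With q = f, the
log-likelihood at p is the log multinomial coefficient minus N H[p]; the coefficient cancels in the
ratio.

For part (ii), the same identity turns H[p] - H[q] into the relative entropy of q with respect to p
(`IsMaxEnt.entropy_sub`), which to second order is half of ∑ (q_α - p_α)² / p_α. On the scale √N (q
- p) the weights exp (N H[q]) therefore become Gaussian. Let the kernel of R carry coordinates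
orthonormal for this quadratic form and adapted to the kernel of R'. The scaled deviations of the
datasets are then points of a shifted lattice of mesh of order 1/√N, of full rank because the kernel
is integral, and they eventually fill every bounded region. Sums of weights times the cell volume
are Riemann sums for Gaussian integrals (`tendsto_lattice_sum`, `tendsto_weight`), and the volume
cancels in the probability.

Passing to the maximizer for R' asymptotically projects away the coordinates along the kernel of R',
so 2N times the entropy gap tends to the squared norm of the remaining D' - D coordinates
(`tendsto_entropyGap`). Under the limiting Gaussian law this is chi-squared, and the boundary of the
limiting rejection region is a null set because that law has no atoms. -/

namespace MaxEntLRT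

/-! ### Entropy maximizers and the exact likelihood ratio -/

section Entropy

variable {A : Type*} [Fintype A] {D : ℕ} {R : Matrix (Fin D) A ℝ} {f p q : A → ℝ}

theorem empirical_mem_stdSimplex {n : A → ℕ} (hn : 0 < ∑ a, n a) :
    empirical n ∈ stdSimplex ℝ A := by
  have h : ((∑ b, n b : ℕ) : ℝ) ≠ 0 := by exact_mod_cast hn.ne'
  refine ⟨fun a => by unfold empirical; positivity, ?_⟩
  simp only [empirical, ← Finset.sum_div]
  rw [← Nat.cast_sum, div_self h]

theorem eqClass_eq_of_mem (hp : p ∈ eqClass R f) : eqClass R p = eqClass R f := by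
  simp [eqClass, hp.2]

theorem maxEnt_eq_of_mem (hp : p ∈ eqClass R f) : maxEnt R p = maxEnt R f := by
  have h : IsMaxEnt R p = IsMaxEnt R f := by
    funext q
    simp [IsMaxEnt, eqClass_eq_of_mem hp]
  rw [maxEnt, h, maxEnt]

theorem eqClass_subset_of_implies {D' : ℕ} {R' : Matrix (Fin D') A ℝ} (h : Implies R' R) :
    eqClass R' f ⊆ eqClass R f := by
  obtain ⟨T, rfl⟩ := h
  rintro p ⟨hp, hpf⟩
  exact ⟨hp, by rw [← mulVec_mulVec, hpf, mulVec_mulVec]⟩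

/-- A microstate with positive probability somewhere in the class has positive probability
under the entropy maximizer. -/
theorem IsMaxEnt.eq_zero_of_eq_zero (hp : IsMaxEnt R f p) (hq : q ∈ eqClass R f) {a : A}
    (ha : p a = 0) : q a = 0 := by
  classical
  by_contra hqa
  have hqpos : 0 < q a := lt_of_le_of_ne (hq.1.1 a) (Ne.symm hqa)
  -- Mixing a fraction t of q into p costs at most order t by concavity, while the coordinate a,
  -- empty in p, gains -q_a t log t. Maximality of p bounds -q_a log t uniformly in t, which fails
  -- as t → 0.
  have key : ∀ t ∈ Ioo (0 : ℝ) 1, -q a * log t ≤ entropy p - entropy q := by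
    rintro t ⟨ht0, ht1⟩
    have hmem : (1 - t) • p + t • q ∈ eqClass R f := by
      refine ⟨convex_stdSimplex ℝ A hp.1.1 hq.1 (by linarith) ht0.le (by ring), ?_⟩
      rw [mulVec_add, mulVec_smul, mulVec_smul, hp.1.2, hq.2, ← add_smul]
      simp
    have hmax : entropy ((1 - t) • p + t • q) ≤ entropy p := hp.2 hmem
    have hconc : (1 - t) * entropy p + t * entropy q + -q a * t * log t
        ≤ entropy ((1 - t) • p + t • q) := by
      have hsum : -q a * t * log t = ∑ b, if b = a then -q a * t * log t else 0 := by simp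
      unfold entropy
      rw [hsum, Finset.mul_sum, Finset.mul_sum, ← Finset.sum_add_distrib,
        ← Finset.sum_add_distrib]
      refine Finset.sum_le_sum fun b _ => ?_
      split_ifs with hb
      · subst hb
        simp only [Pi.add_apply, Pi.smul_apply, smul_eq_mul, ha, negMulLog_zero, mul_zero, zero_add]
        rw [negMulLog, negMulLog, log_mul ht0.ne' hqa]
        apply le_of_eq
        ring
      · rw [add_zero]
        exact concaveOn_negMulLog.2 (hp.1.1.1 b) (hq.1.1 b) (by linarith) ht0.le (by ring)
    have : t * (-q a * log t) ≤ t * (entropy p - entropy q) := by nlinarith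
    exact le_of_mul_le_mul_left this ht0
  -- This t makes the left side of `key` equal to |H[p] - H[q]| + 1.
  have h := key (exp (-((|entropy p - entropy q| + 1) / q a)))
    ⟨exp_pos _, exp_lt_one_iff.2 (by simp only [neg_lt_zero]; positivity)⟩
  rw [log_exp, neg_mul_neg, mul_div_cancel₀ _ hqa] at h
  linarith [le_abs_self (entropy p - entropy q)]

theorem IsMaxEnt.pos (hp : IsMaxEnt R f p) (hq : q ∈ eqClass R f) {a : A} (ha : 0 < q a) :
    0 < p a :=
  lt_of_le_of_ne (hp.1.1.1 a) fun h => ha.ne' (hp.eq_zero_of_eq_zero hq h.symm)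

/-- The cross entropy with the entropy maximizer is constant on the class. -/
theorem IsMaxEnt.sum_mul_log (hp : IsMaxEnt R f p) (hq : q ∈ eqClass R f) :
    -∑ a, q a * log (p a) = entropy p := by
  set γ : ℝ → A → ℝ := fun t => p + t • (q - p) with hγ
  have hd : HasDerivAt (fun t => entropy (γ t)) (∑ a, (q a - p a) * (-log (p a) - 1)) 0 := by
    unfold entropy
    refine HasDerivAt.fun_sum fun a _ => ?_
    -- Where p vanishes so does q: the path is constant in that coordinate, and the singularity of
    -- the logarithm at 0 is never met.
    by_cases ha : p a = 0
    · have hqa := hp.eq_zero_of_eq_zero hq ha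
      simpa [hγ, ha, hqa] using hasDerivAt_const (0 : ℝ) (0 : ℝ)
    · have h1 : HasDerivAt (fun t : ℝ => γ t a) (q a - p a) 0 := by
        simpa [hγ] using ((hasDerivAt_id (0 : ℝ)).mul_const (q a - p a)).const_add (p a)
      have h2 : HasDerivAt negMulLog (-log (p a) - 1) (γ 0 a) := by
        simpa [hγ] using hasDerivAt_negMulLog ha
      exact (h2.comp (0 : ℝ) h1).congr_deriv (mul_comm _ _)
  -- The line stays in the class for small negative t as well, so 0 is a two-sided local maximum and
  -- the derivative vanishes.
  have hmem : ∀ᶠ t in 𝓝 (0 : ℝ), γ t ∈ eqClass R f := by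
    have hnonneg : ∀ᶠ t in 𝓝 (0 : ℝ), ∀ a, 0 ≤ γ t a := by
      refine eventually_all.2 fun a => ?_
      by_cases ha : p a = 0
      · simp [hγ, ha, hp.eq_zero_of_eq_zero hq ha]
      · have hc : Continuous fun t : ℝ => γ t a := by
          simp only [hγ, Pi.add_apply, Pi.smul_apply, smul_eq_mul]
          fun_prop
        have : 0 < γ 0 a := by
          simpa [hγ] using lt_of_le_of_ne (hp.1.1.1 a) (Ne.symm ha)
        filter_upwards [hc.continuousAt.eventually (lt_mem_nhds this)] with t ht using ht.le
    filter_upwards [hnonneg] with t ht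
    refine ⟨⟨ht, ?_⟩, ?_⟩
    · simp [hγ, Finset.sum_add_distrib, ← Finset.mul_sum, hp.1.1.2, hq.1.2]
    · simp [hγ, mulVec_add, mulVec_smul, mulVec_sub, hp.1.2, hq.2]
  have hloc : IsLocalMax (fun t => entropy (γ t)) 0 := by
    filter_upwards [hmem] with t ht
    simpa [hγ] using hp.2 ht
  have h0 := hloc.hasDerivAt_eq_zero hd
  have h1 : ∑ a, (q a - p a) * (-log (p a) - 1)
      = -∑ a, q a * log (p a) + ∑ a, p a * log (p a) - ∑ a, q a + ∑ a, p a := by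
    simp only [← Finset.sum_neg_distrib, ← Finset.sum_add_distrib, ← Finset.sum_sub_distrib]
    exact Finset.sum_congr rfl fun a _ => by ring
  rw [h1, hp.1.1.2, hq.1.2] at h0
  have h2 : entropy p = -∑ a, p a * log (p a) := by simp [entropy, negMulLog]
  linarith

theorem mult_pos {n : A → ℕ} (h : ∀ a, n a ≠ 0 → 0 < p a) : 0 < mult n p := by
  refine mul_pos (by exact_mod_cast Nat.multinomial_pos _ _) (Finset.prod_pos fun a _ => ?_)
  by_cases ha : n a = 0
  · simp [ha]
  · exact pow_pos (h a ha) _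

theorem log_mult {n : A → ℕ} (h : ∀ a, n a ≠ 0 → 0 < p a) :
    log (mult n p) = log (Nat.multinomial Finset.univ n) + ∑ a, n a * log (p a) := by
  have hne : ∀ a ∈ Finset.univ, p a ^ n a ≠ 0 := by
    intro a _
    by_cases ha : n a = 0
    · simp [ha]
    · exact (pow_pos (h a ha) _).ne'
  rw [mult, log_mul (by exact_mod_cast (Nat.multinomial_pos _ _).ne') (Finset.prod_ne_zero_iff.2 hne),
    log_prod hne]
  simp

theorem maxEnt_empirical_pos {n : A → ℕ} (hn : 0 < ∑ a, n a)
    (R : Matrix (Fin D) A ℝ) (a : A) (ha : n a ≠ 0) : 0 < maxEnt R (empirical n) a := by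
  have hf := empirical_mem_stdSimplex hn
  refine (isMaxEnt_maxEnt R hf).pos ⟨hf, rfl⟩ ?_
  have : 0 < n a := Nat.pos_of_ne_zero ha
  unfold empirical
  positivity

/-- The log-likelihood of a dataset at the entropy maximizer of its class. -/
theorem log_mult_maxEnt {n : A → ℕ} (hn : 0 < ∑ a, n a) (R : Matrix (Fin D) A ℝ) :
    log (mult n (maxEnt R (empirical n))) = log (Nat.multinomial Finset.univ n)
      - ((∑ a, n a : ℕ) : ℝ) * entropy (maxEnt R (empirical n)) := by
  have hf := empirical_mem_stdSimplex hn
  rw [log_mult (maxEnt_empirical_pos hn R),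
    ← (isMaxEnt_maxEnt R hf).sum_mul_log ⟨hf, rfl⟩, mul_neg, sub_neg_eq_add, Finset.mul_sum]
  congr 1
  refine Finset.sum_congr rfl fun a _ => ?_
  have h : ((∑ b, n b : ℕ) : ℝ) ≠ 0 := by exact_mod_cast hn.ne'
  rw [empirical]
  field_simp

theorem log_likelihood_ratio {D' : ℕ} {n : A → ℕ} (hn : 0 < ∑ a, n a) (R : Matrix (Fin D) A ℝ)
    (R' : Matrix (Fin D') A ℝ) :
    log (mult n (maxEnt R' (empirical n)) / mult n (maxEnt R (empirical n))) =
      ((∑ a, n a : ℕ) : ℝ) * entropyGap R R' (empirical n) := by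
  rw [log_div (mult_pos (maxEnt_empirical_pos hn R')).ne'
    (mult_pos (maxEnt_empirical_pos hn R)).ne', log_mult_maxEnt hn, log_mult_maxEnt hn,
    entropyGap]
  ring

end Entropy

/-! ### Relative entropy and its quadratic approximation -/

noncomputable section

open InformationTheory

/-- The squared Hellinger term (√t - 1)² is at most `klFun t`, by log √t ≥ 1 - 1/√t; then t - 1
factors as (√t + 1)(√t - 1). -/
theorem sq_sub_one_le_mul_klFun {t : ℝ} (ht : 0 ≤ t) :
    (t - 1) ^ 2 ≤ (√t + 1) ^ 2 * klFun t := by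
  have hs := sq_sqrt ht
  have h : (√t - 1) ^ 2 ≤ klFun t := by
    rcases ht.eq_or_lt with rfl | ht
    · simp [klFun]
    · have hs0 : 0 < √t := sqrt_pos.2 ht
      have h1 := one_sub_inv_le_log_of_pos hs0
      rw [log_sqrt ht.le] at h1
      have h2 : t * (√t)⁻¹ = √t := by field_simp; exact hs.symm
      rw [klFun_apply]
      nlinarith [mul_le_mul_of_nonneg_left h1 ht.le]
  calc (t - 1) ^ 2 = (√t + 1) ^ 2 * (√t - 1) ^ 2 := by
        rw [← mul_pow, show (√t + 1) * (√t - 1) = √t ^ 2 - 1 by ring, hs]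
    _ ≤ _ := by gcongr

theorem abs_klFun_sub_le {y : ℝ} (hy : |y| ≤ 1 / 2) :
    |klFun (1 - y) - y ^ 2 / 2| ≤ 4 * |y| ^ 3 := by
  have h := abs_log_sub_add_sum_range_le (show |y| < 1 by linarith) 2
  simp only [Finset.sum_range_succ, Finset.sum_range_zero] at h
  norm_num at h
  set r := y + y ^ 2 / 2 + log (1 - y) with hr
  have h3 : |r| ≤ 2 * |y| ^ 3 := by
    refine h.trans ?_
    rw [div_le_iff₀ (by linarith)]
    nlinarith [pow_nonneg (abs_nonneg y) 3]
  have h4 : klFun (1 - y) - y ^ 2 / 2 = y ^ 3 / 2 + (1 - y) * r := by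
    rw [klFun_apply, hr]; ring
  have h5 : |1 - y| ≤ 3 / 2 := by
    rw [abs_le] at *; constructor <;> linarith
  calc |klFun (1 - y) - y ^ 2 / 2| ≤ |y ^ 3 / 2| + |(1 - y) * r| := by rw [h4]; exact abs_add_le _ _
    _ = |y| ^ 3 / 2 + |1 - y| * |r| := by rw [abs_div, abs_pow, abs_mul, abs_two]
    _ ≤ |y| ^ 3 / 2 + 3 / 2 * (2 * |y| ^ 3) := by gcongr
    _ ≤ 4 * |y| ^ 3 := by linarith [pow_nonneg (abs_nonneg y) 3]

theorem eventually_abs_klFun_sub_le {ε : ℝ} (hε : 0 < ε) :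
    ∀ᶠ x in 𝓝 (0 : ℝ), |klFun (1 + x) - x ^ 2 / 2| ≤ ε * x ^ 2 := by
  have h1 : ∀ᶠ x in 𝓝 (0 : ℝ), |x| < min (1 / 2) (ε / 4) := by
    have : Tendsto (fun x : ℝ => |x|) (𝓝 0) (𝓝 0) := by
      simpa using (continuous_abs (G := ℝ)).tendsto 0
    exact this.eventually (gt_mem_nhds (by positivity))
  filter_upwards [h1] with x hx
  have h := abs_klFun_sub_le (y := -x) (by rw [abs_neg]; exact (hx.trans_le (min_le_left _ _)).le)
  have h2 : |x| ≤ ε / 4 := (hx.trans_le (min_le_right _ _)).le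
  rw [sub_neg_eq_add, neg_sq, abs_neg] at h
  refine h.trans ?_
  rw [← sq_abs x]
  nlinarith [mul_le_mul_of_nonneg_right h2 (sq_nonneg |x|)]

variable {A : Type*} [Fintype A]

/-- The relative entropy of `q` with respect to the positive distribution `p`. -/
def relEntropy (p q : A → ℝ) : ℝ := ∑ a, p a * klFun (q a / p a)

/-- The quadratic form `∑ w_α ^ 2 / p_α`. -/
def chiSq (p w : A → ℝ) : ℝ := ∑ a, w a ^ 2 / p a

theorem chiSq_smul (p w : A → ℝ) (c : ℝ) : chiSq p (c • w) = c ^ 2 * chiSq p w := by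
  simp [chiSq, Finset.mul_sum, mul_pow, mul_div_assoc]

theorem chiSq_nonneg {p : A → ℝ} (hp : ∀ a, 0 < p a) (w : A → ℝ) : 0 ≤ chiSq p w :=
  Finset.sum_nonneg fun a _ => div_nonneg (sq_nonneg _) (hp a).le

/-- Pythagorean identity: H[p] is replaced by the cross entropy of q with p. The linear terms of
`klFun` cancel because p and q have the same total mass. -/
theorem IsMaxEnt.entropy_sub {D : ℕ} {R : Matrix (Fin D) A ℝ} {f p q : A → ℝ}
    (hp : IsMaxEnt R f p) (hpos : ∀ a, 0 < p a) (hq : q ∈ eqClass R f) :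
    entropy p - entropy q = relEntropy p q := by
  rw [← hp.sum_mul_log hq]
  have h : ∀ a, p a * klFun (q a / p a) = -(q a * log (p a)) - negMulLog (q a) + (p a - q a) := by
    intro a
    have hpa := (hpos a).ne'
    rcases eq_or_ne (q a) 0 with hqa | hqa
    · simp [hqa, klFun]
    · rw [klFun_apply, log_div hqa hpa, negMulLog]
      field_simp
      ring
  simp only [relEntropy, h, Finset.sum_add_distrib, Finset.sum_sub_distrib, entropy, hp.1.1.2,
    hq.1.2, Finset.sum_neg_distrib]
  ring

/-- Global coercivity, valid far from p where the Taylor expansion is useless. It yields the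
Gaussian domination of the weights and confines the maximizer of the larger model to the scale
N^(-1/2). -/
theorem exists_mul_chiSq_le_relEntropy {p : A → ℝ} (hp : ∀ a, 0 < p a) :
    ∃ c > 0, ∀ q ∈ stdSimplex ℝ A, c * chiSq p (q - p) ≤ relEntropy p q := by
  classical
  -- Since q_α ≤ 1, the ratios q_α / p_α are at most 1 / p_α, which makes the Hellinger factor
  -- uniform over the simplex.
  set C : ℝ := 1 + ∑ a, (√(1 / p a) + 1) ^ 2 with hC
  have hC0 : 0 < C := by positivity
  refine ⟨C⁻¹, inv_pos.2 hC0, fun q hq => ?_⟩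
  rw [chiSq, relEntropy, Finset.mul_sum]
  refine Finset.sum_le_sum fun a _ => ?_
  have hpa := hp a
  have hqa : q a ≤ 1 := by
    rw [← hq.2]
    exact Finset.single_le_sum (fun b _ => hq.1 b) (Finset.mem_univ a)
  have ht : 0 ≤ q a / p a := div_nonneg (hq.1 a) hpa.le
  have h1 := sq_sub_one_le_mul_klFun ht
  have h2 : (√(q a / p a) + 1) ^ 2 ≤ C := by
    calc (√(q a / p a) + 1) ^ 2 ≤ (√(1 / p a) + 1) ^ 2 := by gcongr
      _ ≤ ∑ a, (√(1 / p a) + 1) ^ 2 :=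
        Finset.single_le_sum (f := fun a => (√(1 / p a) + 1) ^ 2) (fun b _ => sq_nonneg _)
          (Finset.mem_univ a)
      _ ≤ C := by rw [hC]; linarith
  have h3 : (q a / p a - 1) ^ 2 ≤ C * klFun (q a / p a) :=
    h1.trans (mul_le_mul_of_nonneg_right h2 (klFun_nonneg ht))
  have h4 : (q - p) a ^ 2 / p a = p a * (q a / p a - 1) ^ 2 := by
    rw [Pi.sub_apply]; field_simp
  rw [h4, inv_mul_le_iff₀ hC0]
  nlinarith

theorem eventually_abs_relEntropy_sub_le {p : A → ℝ} (hp : ∀ a, 0 < p a) {ε : ℝ} (hε : 0 < ε) :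
    ∀ᶠ w in 𝓝 (0 : A → ℝ), |relEntropy p (p + w) - chiSq p w / 2| ≤ ε * chiSq p w := by
  have h : ∀ᶠ w in 𝓝 (0 : A → ℝ), ∀ a,
      |klFun (1 + w a / p a) - (w a / p a) ^ 2 / 2| ≤ ε * (w a / p a) ^ 2 := by
    refine eventually_all.2 fun a => ?_
    have ht : Tendsto (fun w : A → ℝ => w a / p a) (𝓝 0) (𝓝 0) := by
      have : Continuous fun w : A → ℝ => w a / p a := by fun_prop
      simpa using this.tendsto 0
    exact ht.eventually (eventually_abs_klFun_sub_le hε)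
  filter_upwards [h] with w hw
  rw [relEntropy, chiSq, Finset.sum_div, ← Finset.sum_sub_distrib, Finset.mul_sum]
  refine (Finset.abs_sum_le_sum_abs _ _).trans (Finset.sum_le_sum fun a _ => ?_)
  have hpa := hp a
  have h1 : p a * klFun ((p + w) a / p a) - w a ^ 2 / p a / 2
      = p a * (klFun (1 + w a / p a) - (w a / p a) ^ 2 / 2) := by
    rw [Pi.add_apply, add_div, div_self hpa.ne']; field_simp
  have h2 : ε * (w a ^ 2 / p a) = p a * (ε * (w a / p a) ^ 2) := by field_simp
  rw [h1, h2, abs_mul, abs_of_pos hpa]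
  exact mul_le_mul_of_nonneg_left (hw a) hpa.le

/-- Second order asymptotics of the relative entropy along scaled null sequences. -/
theorem tendsto_mul_relEntropy_sub {p : A → ℝ} (hp : ∀ a, 0 < p a) {ι : Type*} {l : Filter ι}
    {w : ι → A → ℝ} {N : ι → ℝ} {M : ℝ} (hw : Tendsto w l (𝓝 0)) (hN : ∀ᶠ i in l, 0 ≤ N i)
    (hM : ∀ᶠ i in l, N i * chiSq p (w i) ≤ M) :
    Tendsto (fun i => 2 * N i * relEntropy p (p + w i) - N i * chiSq p (w i)) l (𝓝 0) := by
  rw [Metric.tendsto_nhds]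
  intro ε hε
  have hη : 0 < ε / (2 * (|M| + 1)) := by positivity
  filter_upwards [hw.eventually (eventually_abs_relEntropy_sub_le hp hη), hM, hN] with i hi hb hNi
  rw [dist_zero_right, norm_eq_abs]
  have h1 : 2 * N i * relEntropy p (p + w i) - N i * chiSq p (w i)
      = 2 * N i * (relEntropy p (p + w i) - chiSq p (w i) / 2) := by ring
  rw [h1, abs_mul, abs_of_nonneg (by positivity : 0 ≤ 2 * N i)]
  calc 2 * N i * |relEntropy p (p + w i) - chiSq p (w i) / 2|
      ≤ 2 * N i * (ε / (2 * (|M| + 1)) * chiSq p (w i)) := by gcongr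
    _ = ε / (|M| + 1) * (N i * chiSq p (w i)) := by field_simp
    _ ≤ ε / (|M| + 1) * |M| := by gcongr; exact hb.trans (le_abs_self M)
    _ < ε / (|M| + 1) * (|M| + 1) := by gcongr; norm_num
    _ = ε := by field_simp

theorem tendsto_mul_relEntropy {p : A → ℝ} (hp : ∀ a, 0 < p a) {ι : Type*} {l : Filter ι}
    {w : ι → A → ℝ} {N : ι → ℝ} {y : ℝ} (hw : Tendsto w l (𝓝 0)) (hN : ∀ᶠ i in l, 0 ≤ N i)
    (hy : Tendsto (fun i => N i * chiSq p (w i)) l (𝓝 y)) :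
    Tendsto (fun i => 2 * N i * relEntropy p (p + w i)) l (𝓝 y) := by
  simpa using (tendsto_mul_relEntropy_sub hp hw hN
    (hy.eventually (ge_mem_nhds (lt_add_one y)))).add hy

end

/-! ### Quantiles, Gaussian integrals and the chi-squared law -/

section Gaussian

/-- The cumulative distribution function of an atomless law exceeds a level exactly beyond a
quantile. -/
theorem exists_quantile (ν : Measure ℝ) [IsProbabilityMeasure ν] [NullSingletonClass ν] {u : ℝ}
    (hu : u ∈ Ioo (0 : ℝ) 1) :
    ∃ c, (∀ y, u < cdf ν y ↔ c < y) ∧ ν.real (Ioi c) = 1 - u := by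
  have hcont : Continuous (cdf ν) := by
    refine continuous_iff_continuousAt.2 fun a => ?_
    -- The mass of a point is the jump of the distribution function there, so no atoms means
    -- continuity.
    have h1 : (cdf ν).measure {a} = 0 := by rw [measure_cdf]; exact measure_singleton a
    rw [StieltjesFunction.measure_singleton, ENNReal.ofReal_eq_zero] at h1
    rw [(monotone_cdf ν).continuousAt_iff_leftLim_eq_rightLim, StieltjesFunction.rightLim_eq]
    exact le_antisymm ((monotone_cdf ν).leftLim_le le_rfl) (by linarith)
  set S : Set ℝ := {y | cdf ν y ≤ u} with hS
  have hclosed : IsClosed S := isClosed_le hcont continuous_const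
  have hne : S.Nonempty :=
    (((tendsto_cdf_atBot ν).eventually (gt_mem_nhds hu.1)).exists).imp fun _ h => h.le
  obtain ⟨M, hM⟩ := ((tendsto_cdf_atTop ν).eventually (lt_mem_nhds hu.2)).exists
  have hbdd : BddAbove S := ⟨M, fun y hy => by
    by_contra! h
    exact absurd (hM.trans_le (monotone_cdf ν h.le)) (not_lt.2 hy)⟩
  have hmem : cdf ν (sSup S) ≤ u := hclosed.csSup_mem hne hbdd
  have hgt : ∀ y, sSup S < y → u < cdf ν y := fun y hy => by
    by_contra! h
    exact absurd (le_csSup hbdd h) (not_le.2 hy)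
  have hge : u ≤ cdf ν (sSup S) := by
    have ht : Tendsto (cdf ν) (𝓝[>] sSup S) (𝓝 (cdf ν (sSup S))) :=
      hcont.continuousAt.tendsto.mono_left nhdsWithin_le_nhds
    refine ge_of_tendsto ht ?_
    filter_upwards [self_mem_nhdsWithin] with y hy using (hgt y hy).le
  refine ⟨sSup S, fun y => ⟨fun h => ?_, hgt y⟩, ?_⟩
  · by_contra! hy
    exact absurd (h.trans_le (monotone_cdf ν hy)) (not_lt.2 hmem)
  · rw [← compl_Iic, probReal_compl_eq_one_sub measurableSet_Iic, ← cdf_eq_real,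
      le_antisymm hmem hge]

variable {ι : Type*} [Fintype ι]

theorem prod_gaussianPDFReal (u : ι → ℝ) :
    ∏ i, gaussianPDFReal 0 1 (u i) =
      (∏ _i : ι, (√(2 * π))⁻¹) * exp (-(∑ i, u i ^ 2) / 2) := by
  simp [gaussianPDFReal_def, Finset.prod_mul_distrib, ← exp_sum, Finset.sum_neg_distrib,
    ← Finset.sum_div, neg_div]

theorem pi_gaussianReal_eq_withDensity :
    Measure.pi (fun _ : ι => gaussianReal 0 1) =
      volume.withDensity fun u : ι → ℝ => ENNReal.ofReal (∏ i, gaussianPDFReal 0 1 (u i)) := by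
  refine Measure.pi_eq fun s hs => ?_
  have hint : Integrable (fun u : ι → ℝ => ∏ i, gaussianPDFReal 0 1 (u i)) :=
    Integrable.fintype_prod fun _ => integrable_gaussianPDFReal 0 1
  have hnn : ∀ u : ι → ℝ, 0 ≤ ∏ i, gaussianPDFReal 0 1 (u i) := fun u =>
    Finset.prod_nonneg fun i _ => gaussianPDFReal_nonneg 0 1 _
  rw [withDensity_apply _ (MeasurableSet.univ_pi hs),
    ← ofReal_integral_eq_lintegral_ofReal hint.integrableOn (ae_of_all _ hnn),
    volume_pi, Measure.restrict_pi_pi,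
    integral_fintype_prod_eq_prod (fun (_ : ι) x => gaussianPDFReal 0 1 x),
    ENNReal.ofReal_prod_of_nonneg
      fun i _ => integral_nonneg fun x => gaussianPDFReal_nonneg 0 1 x]
  exact Finset.prod_congr rfl fun i _ =>
    (gaussianReal_apply_eq_integral 0 one_ne_zero (s i)).symm

theorem integrable_exp_neg_mul_sum_sq {c : ℝ} (hc : 0 < c) :
    Integrable fun u : ι → ℝ => exp (-c * ∑ i, u i ^ 2) := by
  have h : Integrable (fun u : ι → ℝ => ∏ i, exp (-c * u i ^ 2)) :=
    Integrable.fintype_prod fun _ => integrable_exp_neg_mul_sq hc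
  simpa [← exp_sum, Finset.mul_sum] using h

theorem pi_gaussianReal_real_apply {B : Set (ι → ℝ)} (hB : MeasurableSet B) :
    (Measure.pi fun _ : ι => gaussianReal 0 1).real B = (∏ _i : ι, (√(2 * π))⁻¹) *
      ∫ u, B.indicator (fun u : ι → ℝ => exp (-(∑ i, u i ^ 2) / 2)) u := by
  have hint : Integrable (fun u : ι → ℝ => ∏ i, gaussianPDFReal 0 1 (u i)) :=
    Integrable.fintype_prod fun _ => integrable_gaussianPDFReal 0 1
  have hnn : ∀ u : ι → ℝ, 0 ≤ ∏ i, gaussianPDFReal 0 1 (u i) := fun u =>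
    Finset.prod_nonneg fun i _ => gaussianPDFReal_nonneg 0 1 _
  rw [measureReal_def, pi_gaussianReal_eq_withDensity, withDensity_apply _ hB,
    ← ofReal_integral_eq_lintegral_ofReal hint.integrableOn (ae_of_all _ hnn),
    ENNReal.toReal_ofReal (integral_nonneg hnn), integral_indicator hB, ← integral_const_mul]
  simp only [prod_gaussianPDFReal]

/-- Gaussian probabilities as ratios of unnormalized integrals. -/
theorem integral_indicator_exp_div {B : Set (ι → ℝ)} (hB : MeasurableSet B) :
    (∫ u, B.indicator (fun u : ι → ℝ => exp (-(∑ i, u i ^ 2) / 2)) u) /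
      (∫ u : ι → ℝ, exp (-(∑ i, u i ^ 2) / 2)) =
      (Measure.pi fun _ : ι => gaussianReal 0 1).real B := by
  have h1 := pi_gaussianReal_real_apply (ι := ι) MeasurableSet.univ
  rw [probReal_univ] at h1
  simp only [indicator_univ] at h1
  rw [pi_gaussianReal_real_apply hB, div_eq_iff (right_ne_zero_of_mul_eq_one h1.symm),
    mul_right_comm, ← h1, one_mul]

theorem volume_absolutelyContinuous_pi_gaussianReal :
    (volume : Measure (ι → ℝ)) ≪ Measure.pi fun _ : ι => gaussianReal 0 1 := by
  rw [pi_gaussianReal_eq_withDensity]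
  refine withDensity_absolutelyContinuous' ?_ (ae_of_all _ fun u => ?_)
  · exact ((Finset.measurable_prod _ fun i _ =>
      (measurable_gaussianPDFReal 0 1).comp (measurable_pi_apply i)).ennreal_ofReal).aemeasurable
  · simpa using Finset.prod_pos fun i _ => gaussianPDFReal_pos 0 1 (u i) one_ne_zero

theorem volume_sum_sq_eq [Nonempty ι] (c : ℝ) :
    volume {u : ι → ℝ | ∑ i, u i ^ 2 = c} = 0 := by
  have hs : MeasurableSet {u : ι → ℝ | ∑ i, u i ^ 2 = c} :=
    measurableSet_eq_fun (by fun_prop) measurable_const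
  rw [← (PiLp.volume_preserving_ofLp ι).measure_preimage hs.nullMeasurableSet]
  refine measure_mono_null (fun u hu => ?_)
    (Measure.addHaar_sphere volume (0 : EuclideanSpace ℝ ι) (√c))
  rw [mem_sphere_zero_iff_norm, EuclideanSpace.norm_eq]
  simpa using congrArg sqrt hu

theorem measurable_sum_sq : Measurable fun x : ι → ℝ => ∑ i, x i ^ 2 := by fun_prop

instance isProbabilityMeasure_chiSquared (k : ℕ) : IsProbabilityMeasure (chiSquared k) :=
  Measure.isProbabilityMeasure_map measurable_sum_sq.aemeasurable

theorem nullSingletonClass_chiSquared {k : ℕ} (hk : 0 < k) : NullSingletonClass (chiSquared k) := by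
  have : Nonempty (Fin k) := ⟨⟨0, hk⟩⟩
  refine ⟨fun c => ?_⟩
  rw [chiSquared, Measure.map_apply measurable_sum_sq (measurableSet_singleton c),
    pi_gaussianReal_eq_withDensity]
  exact withDensity_absolutelyContinuous _ _ (volume_sum_sq_eq c)

variable {κ : Type*} [Fintype κ]

/-- A marginal of the standard Gaussian law has chi-squared distributed squared norm. -/
theorem pi_gaussianReal_sum_sq_inl (k : ℕ) {s : Set ℝ} (hs : MeasurableSet s) :
    Measure.pi (fun _ : Fin k ⊕ κ => gaussianReal 0 1) {u | ∑ i, u (Sum.inl i) ^ 2 ∈ s} =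
      chiSquared k s := by
  have h1 := measurePreserving_sumPiEquivProdPi (X := fun _ : Fin k ⊕ κ => ℝ)
    fun _ => gaussianReal 0 1
  have h2 : MeasurableSet {v : (Fin k → ℝ) × (κ → ℝ) | ∑ i, v.1 i ^ 2 ∈ s} :=
    (measurable_sum_sq.comp measurable_fst) hs
  have h3 := h1.measure_preimage h2.nullMeasurableSet
  rw [chiSquared, Measure.map_apply measurable_sum_sq hs]
  refine h3.trans ?_
  have h4 : {v : (Fin k → ℝ) × (κ → ℝ) | ∑ i, v.1 i ^ 2 ∈ s}
      = ((fun x : Fin k → ℝ => ∑ i, x i ^ 2) ⁻¹' s) ×ˢ univ := by ext; simp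
  rw [h4, Measure.prod_prod, measure_univ, mul_one]

/-- The critical value is attained only on a Lebesgue null set, so almost every limit point lies
strictly inside or strictly outside the rejection region. -/
theorem ae_sum_sq_inl_ne {k : ℕ} (hk : 0 < k) (c : ℝ) :
    ∀ᵐ u : Fin k ⊕ κ → ℝ, ∑ i, u (Sum.inl i) ^ 2 ≠ c := by
  have := nullSingletonClass_chiSquared hk
  refine volume_absolutelyContinuous_pi_gaussianReal ?_
  have h := pi_gaussianReal_sum_sq_inl (κ := κ) k (measurableSet_singleton c)
  rw [measure_singleton] at h
  simpa [compl_ofPred] using h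

end Gaussian

/-! ### Adapted orthonormal coordinates and the integer lattice -/

section Coordinates

variable {A : Type*} [Fintype A]

/-- Orthonormal coordinates, for the quadratic form `chiSq p`, of a subspace `V`, adapted to a
smaller subspace `V'`. -/
theorem exists_adapted_coordinates {p : A → ℝ} (hp : ∀ a, 0 < p a) {V V' : Submodule ℝ (A → ℝ)}
    (hV : V' ≤ V) {k : ℕ} (hk : Module.finrank ℝ V' + k = Module.finrank ℝ V) :
    ∃ (d : ℕ) (ψ : (Fin k ⊕ Fin d → ℝ) →ₗ[ℝ] (A → ℝ)),
      (∀ u, chiSq p (ψ u) = ∑ i, u i ^ 2) ∧ LinearMap.range ψ = V ∧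
      ∀ u, ψ u ∈ V' ↔ ∀ i, u (Sum.inl i) = 0 := by
  classical
  -- Rescaling by √p_α turns `chiSq p` into the squared Euclidean norm, so orthogonal complements
  -- and orthonormal bases become available.
  let T : EuclideanSpace ℝ A ≃ₗ[ℝ] (A → ℝ) :=
    (WithLp.linearEquiv 2 ℝ (A → ℝ)).trans
      (LinearEquiv.piCongrRight fun a => LinearEquiv.smulOfNeZero ℝ ℝ (√(p a))
        (sqrt_pos.2 (hp a)).ne')
  have hT : ∀ x a, T x a = √(p a) * x a := fun x a => rfl
  have hchi : ∀ x, chiSq p (T x) = ‖x‖ ^ 2 := by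
    intro x
    rw [EuclideanSpace.norm_sq_eq, chiSq]
    refine Finset.sum_congr rfl fun a _ => ?_
    rw [hT, mul_pow, sq_sqrt (hp a).le, mul_div_cancel_left₀ _ (hp a).ne', norm_eq_abs, sq_abs]
  set W : Submodule ℝ (EuclideanSpace ℝ A) := V.comap T.toLinearMap with hW
  set W' : Submodule ℝ (EuclideanSpace ℝ A) := V'.comap T.toLinearMap with hW'
  have hWW : W' ≤ W := Submodule.comap_mono hV
  have hfin : ∀ X : Submodule ℝ (A → ℝ),
      Module.finrank ℝ (X.comap T.toLinearMap) = Module.finrank ℝ X := fun X =>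
    (LinearEquiv.ofSubmodule' T X).finrank_eq
  have hc : Module.finrank ℝ (W'ᗮ ⊓ W : Submodule ℝ (EuclideanSpace ℝ A)) = k := by
    have h := Submodule.finrank_add_inf_finrank_orthogonal hWW
    rw [hW, hW', hfin, hfin, ← hk] at h
    exact Nat.add_left_cancel h
  let e₀ := (stdOrthonormalBasis ℝ (W'ᗮ ⊓ W : Submodule ℝ (EuclideanSpace ℝ A))).reindex
    (finCongr hc)
  let e₁ := stdOrthonormalBasis ℝ W'
  let φ₀ : (Fin k ⊕ Fin (Module.finrank ℝ W') → ℝ) →ₗ[ℝ]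
      (W'ᗮ ⊓ W : Submodule ℝ (EuclideanSpace ℝ A)) :=
    e₀.repr.symm.toLinearEquiv.toLinearMap ∘ₗ (WithLp.linearEquiv 2 ℝ _).symm.toLinearMap ∘ₗ
      LinearMap.funLeft ℝ ℝ Sum.inl
  let φ₁ : (Fin k ⊕ Fin (Module.finrank ℝ W') → ℝ) →ₗ[ℝ] W' :=
    e₁.repr.symm.toLinearEquiv.toLinearMap ∘ₗ (WithLp.linearEquiv 2 ℝ _).symm.toLinearMap ∘ₗ
      LinearMap.funLeft ℝ ℝ Sum.inr
  have hφ₀ : ∀ u, ‖φ₀ u‖ ^ 2 = ∑ i, u (Sum.inl i) ^ 2 := fun u => by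
    simp [φ₀, EuclideanSpace.norm_sq_eq, LinearMap.funLeft]
  have hφ₁ : ∀ u, ‖φ₁ u‖ ^ 2 = ∑ i, u (Sum.inr i) ^ 2 := fun u => by
    simp [φ₁, EuclideanSpace.norm_sq_eq, LinearMap.funLeft]
  refine ⟨_, T.toLinearMap ∘ₗ ((Submodule.subtype _) ∘ₗ φ₀ + W'.subtype ∘ₗ φ₁), ?_, ?_, ?_⟩
  · intro u
    change chiSq p (T ((φ₀ u : EuclideanSpace ℝ A) + φ₁ u)) = _
    have horth : inner ℝ (φ₀ u : EuclideanSpace ℝ A) (φ₁ u) = 0 :=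
      Submodule.inner_left_of_mem_orthogonal (φ₁ u).2 (φ₀ u).2.1
    have h := norm_add_sq_eq_norm_sq_add_norm_sq_of_inner_eq_zero _ _ horth
    simp only [← sq] at h
    rw [hchi, h, ← Submodule.coe_norm, ← Submodule.coe_norm, hφ₀, hφ₁, Fintype.sum_sum_type]
  · ext w
    constructor
    · rintro ⟨u, rfl⟩
      exact W.add_mem (φ₀ u).2.2 (hWW (φ₁ u).2)
    · intro hw
      have hx : T.symm w ∈ W := by simpa [hW] using hw
      rw [← Submodule.sup_orthogonal_inf_of_hasOrthogonalProjection hWW] at hx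
      obtain ⟨y, hy, z, hz, hyz⟩ := Submodule.mem_sup.1 hx
      refine ⟨Sum.elim (e₀.repr ⟨z, hz⟩) (e₁.repr ⟨y, hy⟩), ?_⟩
      have h0 : φ₀ (Sum.elim (e₀.repr ⟨z, hz⟩) (e₁.repr ⟨y, hy⟩)) = ⟨z, hz⟩ :=
        e₀.repr.symm_apply_apply _
      have h1 : φ₁ (Sum.elim (e₀.repr ⟨z, hz⟩) (e₁.repr ⟨y, hy⟩)) = ⟨y, hy⟩ :=
        e₁.repr.symm_apply_apply _
      simp [h0, h1, add_comm z y, hyz]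
  · intro u
    change (φ₀ u : EuclideanSpace ℝ A) + φ₁ u ∈ W' ↔ _
    rw [W'.add_mem_iff_left (φ₁ u).2]
    have h2 : (φ₀ u : EuclideanSpace ℝ A) ∈ W' ↔ ‖φ₀ u‖ ^ 2 = 0 := by
      rw [sq_eq_zero_iff, norm_eq_zero]
      constructor
      · intro h
        have := Submodule.inner_left_of_mem_orthogonal h (φ₀ u).2.1
        exact Subtype.ext (inner_self_eq_zero.1 this)
      · intro h
        simp [h]
    rw [h2, hφ₀, Finset.sum_eq_zero_iff_of_nonneg fun i _ => sq_nonneg _]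
    simp

theorem finrank_ker_mulVecLin_add {D : ℕ} {R : Matrix (Fin D) A ℝ} (hR : IsArchitecture R) :
    Module.finrank ℝ (LinearMap.ker R.mulVecLin) + D = Fintype.card A := by
  have h := R.mulVecLin.finrank_range_add_finrank_ker
  have h2 : Module.finrank ℝ (LinearMap.range R.mulVecLin) = D := by
    simpa [Matrix.rank] using hR.linearIndependent_rows.rank_matrix
  rw [h2, Module.finrank_fintype_fun_eq_card] at h
  omega

/-- The `Sum.inl` coordinates are transversal to the kernel of R' inside that of R. Their number is
the difference of the kernel dimensions, which by rank-nullity is D' - D, the number of degrees of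
freedom. -/
theorem exists_model_coordinates {D D' : ℕ} {R : Matrix (Fin D) A ℝ} {R' : Matrix (Fin D') A ℝ}
    (hR : IsArchitecture R) (hR' : IsArchitecture R') (hRR' : Implies R' R) (hD : D ≤ D')
    {p : A → ℝ} (hp : ∀ a, 0 < p a) :
    ∃ (d : ℕ) (ψ : (Fin (D' - D) ⊕ Fin d → ℝ) →ₗ[ℝ] (A → ℝ)),
      (∀ u, chiSq p (ψ u) = ∑ i, u i ^ 2) ∧ (∀ w, R *ᵥ w = 0 ↔ ∃ u, ψ u = w) ∧
      ∀ u, R' *ᵥ ψ u = 0 ↔ ∀ i, u (Sum.inl i) = 0 := by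
  have hV : LinearMap.ker R'.mulVecLin ≤ LinearMap.ker R.mulVecLin := by
    obtain ⟨T, rfl⟩ := hRR'
    intro w hw
    simp only [LinearMap.mem_ker, mulVecLin_apply] at hw ⊢
    rw [← mulVec_mulVec, hw, mulVec_zero]
  have h1 := finrank_ker_mulVecLin_add hR
  have h2 := finrank_ker_mulVecLin_add hR'
  obtain ⟨d, ψ, h3, h4, h5⟩ := exists_adapted_coordinates hp hV (k := D' - D) (by omega)
  refine ⟨d, ψ, h3, fun w => ?_, fun u => ?_⟩
  · rw [← LinearMap.mem_range, h4, LinearMap.mem_ker, mulVecLin_apply]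
  · rw [← h5, LinearMap.mem_ker, mulVecLin_apply]

/-- The integer points of a subspace spanned by integer vectors have a basis. -/
theorem exists_integral_basis {D : ℕ} {R : Matrix (Fin D) A ℝ} (hR : HasIntegralKernel R)
    {ι : Type*} [Fintype ι] {ψ : (ι → ℝ) →ₗ[ℝ] (A → ℝ)} (hψ : Function.Injective ψ)
    (hrange : ∀ w, R *ᵥ w = 0 ↔ ∃ u, ψ u = w) :
    ∃ (m : ℕ) (b : Module.Basis (Fin m) ℝ (ι → ℝ)),
      ∀ u, u ∈ Submodule.span ℤ (Set.range b) ↔ ∃ z : A → ℤ, ψ u = fun a => (z a : ℝ) := by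
  classical
  let L₀ : Submodule ℤ (A → ℝ) := Submodule.span ℤ (Set.range (Pi.basisFun ℝ A))
  have hL₀ : ∀ w, w ∈ L₀ ↔ ∃ z : A → ℤ, w = fun a => (z a : ℝ) := by
    intro w
    rw [Module.Basis.mem_span_iff_repr_mem]
    simp only [Pi.basisFun_repr, Set.mem_range, algebraMap_int_eq, eq_intCast]
    constructor
    · intro h
      choose z hz using h
      exact ⟨z, funext fun a => (hz a).symm⟩
    · rintro ⟨z, rfl⟩ a
      exact ⟨z a, rfl⟩
  let L := ZLattice.comap ℝ L₀ ψ
  have hL : ∀ u, u ∈ L ↔ ∃ z : A → ℤ, ψ u = fun a => (z a : ℝ) := fun u => hL₀ (ψ u)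
  have hdisc : DiscreteTopology L :=
    ZLattice.comap_discreteTopology ℝ L₀ ψ.continuous_of_finiteDimensional hψ
  have hlat : IsZLattice ℝ L := by
    refine ⟨eq_top_iff.2 fun u _ => ?_⟩
    -- Integrality of the kernel enters here: it gives the lattice full rank.
    have h := hR (ψ u) ((hrange _).2 ⟨u, rfl⟩)
    have hsub : {w : A → ℝ | R *ᵥ w = 0 ∧ ∃ z : A → ℤ, w = fun a => (z a : ℝ)} ⊆
        ψ '' (L : Set (ι → ℝ)) := by
      rintro w ⟨hw, hz⟩
      obtain ⟨v, rfl⟩ := (hrange w).1 hw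
      exact ⟨v, (hL v).2 hz, rfl⟩
    have h' := Submodule.span_mono hsub h
    rw [Submodule.span_image] at h'
    obtain ⟨v, hv, hvu⟩ := h'
    exact hψ hvu ▸ hv
  have := ZLattice.module_finite ℝ L
  have := ZLattice.module_free ℝ L
  let b := (Module.finBasis ℤ L).ofZLatticeBasis ℝ L
  refine ⟨_, b, fun u => ?_⟩
  rw [Module.Basis.ofZLatticeBasis_span, hL]

end Coordinates

/-! ### Riemann sums over shifted lattices -/

section LatticeSums

variable {ι : Type*} [Fintype ι] {m : ℕ}

/-- The cell at `x` of the lattice spanned by `b`, scaled down by the factor `r`. -/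
def cell (b : Module.Basis (Fin m) ℝ (ι → ℝ)) (r : ℝ) (x : ι → ℝ) : Set (ι → ℝ) :=
  {u | r • (u - x) ∈ ZSpan.fundamentalDomain b}

variable (b : Module.Basis (Fin m) ℝ (ι → ℝ))

theorem measurableSet_cell (r : ℝ) (x : ι → ℝ) : MeasurableSet (cell b r x) := by
  have h : Measurable fun u : ι → ℝ => r • (u - x) := by fun_prop
  exact h (ZSpan.fundamentalDomain_measurableSet b)

theorem volume_cell {r : ℝ} (hr : 0 < r) (x : ι → ℝ) :
    volume (cell b r x) =
      ENNReal.ofReal |(r ^ Module.finrank ℝ (ι → ℝ))⁻¹| * volume (ZSpan.fundamentalDomain b) := by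
  have h : cell b r x = (fun u => u - x) ⁻¹' ((fun u => r • u) ⁻¹' ZSpan.fundamentalDomain b) := rfl
  simp only [h, sub_eq_add_neg]
  rw [measure_preimage_add_right, Measure.addHaar_preimage_smul _ hr.ne']

theorem volume_real_cell_pos {r : ℝ} (hr : 0 < r) (x : ι → ℝ) : 0 < volume.real (cell b r x) := by
  rw [measureReal_def, volume_cell b hr, ENNReal.toReal_mul]
  refine mul_pos ?_ (ENNReal.toReal_pos (ZSpan.measure_fundamentalDomain_ne_zero b)
    (ZSpan.fundamentalDomain_isBounded b).measure_lt_top.ne)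
  rw [ENNReal.toReal_ofReal (abs_nonneg _)]
  positivity

theorem volume_real_cell_eq {r : ℝ} (hr : 0 < r) (x : ι → ℝ) :
    volume.real (cell b r x) = volume.real (cell b r 0) := by
  rw [measureReal_def, measureReal_def, volume_cell b hr, volume_cell b hr]

theorem volume_cell_lt_top {r : ℝ} (hr : 0 < r) (x : ι → ℝ) : volume (cell b r x) < ⊤ := by
  rw [volume_cell b hr]
  exact ENNReal.mul_lt_top ENNReal.ofReal_lt_top (ZSpan.fundamentalDomain_isBounded b).measure_lt_top

variable {b} in
-- Disjointness of the cells: modulo the lattice, r • (u - x) and r • (u - y) agree, and a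
-- fundamental domain contains only one representative.
theorem eq_of_mem_cell {r : ℝ} (hr : 0 < r) {x y u : ι → ℝ} (hx : u ∈ cell b r x)
    (hy : u ∈ cell b r y) (h : r • (x - y) ∈ Submodule.span ℤ (Set.range b)) : x = y := by
  have h1 : ZSpan.fract b (r • (u - x)) = ZSpan.fract b (r • (u - y)) := by
    rw [ZSpan.fract_eq_fract]
    convert h using 1
    module
  rw [ZSpan.fract_eq_self.2 hx, ZSpan.fract_eq_self.2 hy] at h1
  have h2 := smul_right_injective (ι → ℝ) hr.ne' h1
  exact sub_right_injective h2

theorem exists_norm_sub_le_of_mem_cell :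
    ∃ C > 0, ∀ r > 0, ∀ x u, u ∈ cell b r x → ‖u - x‖ ≤ C / r := by
  obtain ⟨C, hC0, hC⟩ := (ZSpan.fundamentalDomain_isBounded b).exists_pos_norm_le
  refine ⟨C, hC0, fun r hr x u hu => ?_⟩
  have := hC _ hu
  rwa [norm_smul, norm_eq_abs, abs_of_pos hr, mul_comm, ← le_div_iff₀ hr] at this

theorem exists_mem_cell {r : ℝ} (hr : 0 < r) (x u : ι → ℝ) :
    ∃ v ∈ Submodule.span ℤ (Set.range b), u ∈ cell b r (x + r⁻¹ • v) := by
  refine ⟨ZSpan.floor b (r • (u - x)), (ZSpan.floor b (r • (u - x))).2, ?_⟩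
  have h : r • (u - (x + r⁻¹ • (ZSpan.floor b (r • (u - x)) : ι → ℝ))) =
      ZSpan.fract b (r • (u - x)) := by
    rw [ZSpan.fract_apply, ← sub_sub, smul_sub _ (u - x), smul_inv_smul₀ hr.ne']
  rw [cell, Set.mem_ofPred_eq, h]
  exact ZSpan.fract_mem_fundamentalDomain b _

/-- Sums over the points of shifted lattices of increasing density converge, after multiplication
with the volume of a cell, to integrals, under a Gaussian bound. -/
theorem tendsto_lattice_sum {α β : Type*} {l : Filter α} [l.IsCountablyGenerated]
    {S : α → Finset β} {x : α → β → ι → ℝ} {r : α → ℝ} (hr : Tendsto r l atTop)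
    (hinj : ∀ᶠ i in l, Set.InjOn (x i) (S i))
    (hlat : ∀ᶠ i in l, ∀ n ∈ S i, ∀ n' ∈ S i,
      r i • (x i n - x i n') ∈ Submodule.span ℤ (Set.range b))
    (hcover : ∀ u, ∀ᶠ i in l, ∃ n ∈ S i, u ∈ cell b (r i) (x i n))
    {W : α → β → ℝ} {c : ℝ} (hc : 0 < c)
    (hW : ∀ᶠ i in l, ∀ n ∈ S i, |W i n| ≤ exp (-c * ∑ j, x i n j ^ 2)) {g : (ι → ℝ) → ℝ}
    (hg : ∀ᵐ u, ∀ n : α → β, (∀ᶠ i in l, n i ∈ S i) → Tendsto (fun i => x i (n i)) l (𝓝 u) →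
      Tendsto (fun i => W i (n i)) l (𝓝 (g u))) :
    Tendsto (fun i => volume.real (cell b (r i) 0) * ∑ n ∈ S i, W i n) l (𝓝 (∫ u, g u)) := by
  classical
  obtain ⟨C, hC0, hC⟩ := exists_norm_sub_le_of_mem_cell b
  -- The step function with value W on each cell; its integral is the sum times the common cell
  -- volume, so dominated convergence applies.
  set F : α → (ι → ℝ) → ℝ := fun i u =>
    ∑ n ∈ S i, (cell b (r i) (x i n)).indicator (fun _ => W i n) u with hF
  have hr0 : ∀ᶠ i in l, 1 ≤ r i := hr.eventually (eventually_ge_atTop 1)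
  have hint : ∀ᶠ i in l, ∫ u, F i u = volume.real (cell b (r i) 0) * ∑ n ∈ S i, W i n := by
    filter_upwards [hr0] with i hi
    have hi0 : 0 < r i := by linarith
    rw [hF, integral_finsetSum, Finset.mul_sum]
    · refine Finset.sum_congr rfl fun n _ => ?_
      rw [integral_indicator (measurableSet_cell b _ _), setIntegral_const, smul_eq_mul,
        volume_real_cell_eq b hi0]
    · intro n _
      exact (integrable_indicator_iff (measurableSet_cell b _ _)).2
        (integrableOn_const (volume_cell_lt_top b hi0 _).ne)
  have hFeq : ∀ᶠ i in l, ∀ n ∈ S i, ∀ u ∈ cell b (r i) (x i n), F i u = W i n := by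
    filter_upwards [hr0, hinj, hlat] with i hi hinji hlati n hn u hu
    have hi0 : 0 < r i := by linarith
    rw [hF]
    simp only
    rw [Finset.sum_eq_single n, indicator_of_mem hu]
    · intro n' hn' hne
      refine indicator_of_notMem (fun hu' => hne ?_) _
      exact hinji hn' hn (eq_of_mem_cell hi0 hu' hu (hlati n' hn' n hn))
    · exact fun h => absurd hn h
  refine Tendsto.congr' hint ?_
  refine tendsto_integral_filter_of_dominated_convergence
    -- For r ≥ 1 a point of a cell is within C of its base point, so u_j² ≤ 2 x_j² + 2 C²; hence
    -- half the Gaussian rate and the constant factor.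
    (fun u => exp (c * (Fintype.card ι * C ^ 2)) * exp (-(c / 2) * ∑ j, u j ^ 2)) ?_ ?_
    ((integrable_exp_neg_mul_sum_sq (half_pos hc)).const_mul _) ?_
  · refine Eventually.of_forall fun i => Measurable.aestronglyMeasurable ?_
    exact Finset.measurable_sum _ fun n _ => measurable_const.indicator (measurableSet_cell b _ _)
  · filter_upwards [hr0, hW, hFeq] with i hi hWi hFi
    refine ae_of_all _ fun u => ?_
    by_cases h : ∃ n ∈ S i, u ∈ cell b (r i) (x i n)
    · obtain ⟨n, hn, hu⟩ := h
      rw [hFi n hn u hu, norm_eq_abs, ← exp_add]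
      refine (hWi n hn).trans (exp_le_exp.2 ?_)
      have hux : ‖u - x i n‖ ≤ C :=
        (hC (r i) (by linarith) _ _ hu).trans (div_le_self hC0.le hi)
      have hj : ∀ j, u j ^ 2 ≤ 2 * x i n j ^ 2 + 2 * C ^ 2 := by
        intro j
        have h1 : |u j - x i n j| ≤ C := (norm_le_pi_norm (u - x i n) j).trans hux
        have h2 : (u j - x i n j) ^ 2 ≤ C ^ 2 := by
          rw [← sq_abs]
          gcongr
        nlinarith [sq_nonneg (u j - 2 * x i n j)]
      have hsum : ∑ j, u j ^ 2 ≤ 2 * ∑ j, x i n j ^ 2 + 2 * (Fintype.card ι * C ^ 2) := by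
        refine (Finset.sum_le_sum fun j _ => hj j).trans_eq ?_
        rw [Finset.sum_add_distrib, ← Finset.mul_sum]
        simp
        ring
      nlinarith
    · push Not at h
      have : F i u = 0 := Finset.sum_eq_zero fun n hn => indicator_of_notMem (h n hn) _
      rw [this, norm_zero]
      positivity
  · filter_upwards [hg] with u hu
    by_cases hl : l = ⊥
    · rw [hl]; exact tendsto_bot
    have : l.NeBot := ⟨hl⟩
    obtain ⟨i₀, n₀, -⟩ := (hcover u).exists
    -- The cells containing u have diameter of order 1/r, so their base points tend to u. The value
    -- n₀ only fills the indices where no cell contains u.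
    set n : α → β := fun i =>
      if h : ∃ n ∈ S i, u ∈ cell b (r i) (x i n) then h.choose else n₀ with hn
    have hnS : ∀ᶠ i in l, n i ∈ S i ∧ u ∈ cell b (r i) (x i (n i)) := by
      filter_upwards [hcover u] with i hi
      rw [hn]
      simp only [dif_pos hi]
      exact hi.choose_spec
    have hx : Tendsto (fun i => x i (n i)) l (𝓝 u) := by
      rw [tendsto_iff_norm_sub_tendsto_zero]
      refine squeeze_zero' (Eventually.of_forall fun i => norm_nonneg _) ?_
        (tendsto_const_nhds.div_atTop hr : Tendsto (fun i => C / r i) l (𝓝 0))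
      filter_upwards [hnS, hr0] with i hi hri
      rw [norm_sub_rev]
      exact hC (r i) (by linarith) _ _ hi.2
    refine (hu n (hnS.mono fun i hi => hi.1) hx).congr' ?_
    filter_upwards [hnS, hFeq] with i hi hFi
    exact (hFi (n i) hi.1 u hi.2).symm

end LatticeSums

/-! ### Limit of the scaled entropy gap -/

section GapAsymptotics

variable {A : Type*} [Fintype A] {D D' : ℕ} {R : Matrix (Fin D) A ℝ} {R' : Matrix (Fin D') A ℝ}
  {f p : A → ℝ}

theorem sum_eq_zero_of_mulVec_eq_zero (hR : IsArchitecture R) {w : A → ℝ} (hw : R *ᵥ w = 0) :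
    ∑ a, w a = 0 := by
  have h : Submodule.span ℝ (Set.range R.row) ≤ LinearMap.ker (dotProductBilin ℝ ℝ w) := by
    rw [Submodule.span_le]
    rintro _ ⟨i, rfl⟩
    exact (dotProduct_comm _ _).trans (congrFun hw i)
  simpa [dotProduct] using h hR.normalization

theorem add_mem_eqClass (hR : IsArchitecture R) (hp : p ∈ eqClass R f) {w : A → ℝ}
    (hw : R *ᵥ w = 0) (h : ∀ a, 0 ≤ p a + w a) : p + w ∈ eqClass R f := by
  refine ⟨⟨h, ?_⟩, ?_⟩
  · simp [Finset.sum_add_distrib, hp.1.2, sum_eq_zero_of_mulVec_eq_zero hR hw]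
  · rw [mulVec_add, hp.2, hw, add_zero]

theorem sq_le_chiSq {w : A → ℝ} (hp : ∀ a, 0 < p a) (a : A) : w a ^ 2 ≤ p a * chiSq p w := by
  rw [← div_le_iff₀' (hp a)]
  exact Finset.single_le_sum (f := fun a => w a ^ 2 / p a)
    (fun b _ => div_nonneg (sq_nonneg _) (hp b).le) (Finset.mem_univ a)

theorem tendsto_zero_of_chiSq {α : Type*} {l : Filter α} {w : α → A → ℝ} (hp : ∀ a, 0 < p a)
    (h : Tendsto (fun i => chiSq p (w i)) l (𝓝 0)) : Tendsto w l (𝓝 0) := by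
  refine tendsto_pi_nhds.2 fun a => ?_
  refine squeeze_zero_norm (fun i => abs_le_sqrt (sq_le_chiSq hp a)) ?_
  simpa using (h.const_mul (p a)).sqrt

theorem tendsto_inv_smul {B ι : Type*} [Fintype ι] (ψ : (ι → ℝ) →ₗ[ℝ] (B → ℝ)) {α : Type*}
    {l : Filter α} {r : α → ℝ} (hr : Tendsto r l atTop) {x : α → ι → ℝ} {u : ι → ℝ}
    (hx : Tendsto x l (𝓝 u)) : Tendsto (fun i => (r i)⁻¹ • ψ (x i)) l (𝓝 0) := by
  have h := (tendsto_inv_atTop_zero.comp hr).smul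
    ((ψ.continuous_of_finiteDimensional.tendsto u).comp hx)
  simpa using h

theorem sq_mul_chiSq_inv_smul {ι : Type*} [Fintype ι] {ψ : (ι → ℝ) →ₗ[ℝ] (A → ℝ)}
    (hψ : ∀ u, chiSq p (ψ u) = ∑ i, u i ^ 2) {r : ℝ} (hr : r ≠ 0) (u : ι → ℝ) :
    r ^ 2 * chiSq p (r⁻¹ • ψ u) = ∑ i, u i ^ 2 := by
  rw [chiSq_smul, hψ]
  field_simp

/-- Second order asymptotics of the entropy deficit near the entropy maximizer. -/
theorem tendsto_relEntropy_coordinates {ι : Type*} [Fintype ι] {ψ : (ι → ℝ) →ₗ[ℝ] (A → ℝ)}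
    (hpos : ∀ a, 0 < p a) (hψ : ∀ u, chiSq p (ψ u) = ∑ i, u i ^ 2) {α : Type*}
    {l : Filter α} {r : α → ℝ} (hr : Tendsto r l atTop) {x : α → ι → ℝ} {u : ι → ℝ}
    (hx : Tendsto x l (𝓝 u)) :
    Tendsto (fun i => 2 * r i ^ 2 * relEntropy p (p + (r i)⁻¹ • ψ (x i))) l
      (𝓝 (∑ j, u j ^ 2)) := by
  refine tendsto_mul_relEntropy hpos (tendsto_inv_smul ψ hr hx)
    (Eventually.of_forall fun i => sq_nonneg _) ?_
  have h : Tendsto (fun i => ∑ j, x i j ^ 2) l (𝓝 (∑ j, u j ^ 2)) :=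
    tendsto_finsetSum _ fun j _ => (tendsto_pi_nhds.1 hx j).pow 2
  refine h.congr' ?_
  filter_upwards [hr.eventually (eventually_gt_atTop 0)] with i hi
  exact (sq_mul_chiSq_inv_smul hψ hi.ne' _).symm

/-- The scaled entropy gap converges to the squared norm of the coordinates transversal to the
larger model. -/
theorem tendsto_entropyGap (hR : IsArchitecture R) (hRR' : Implies R' R)
    (hp : IsMaxEnt R f p) (hpos : ∀ a, 0 < p a) (hf : f ∈ stdSimplex ℝ A) {k d : ℕ}
    {ψ : (Fin k ⊕ Fin d → ℝ) →ₗ[ℝ] (A → ℝ)} (hψ : ∀ u, chiSq p (ψ u) = ∑ i, u i ^ 2)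
    (hrange : ∀ w, R *ᵥ w = 0 ↔ ∃ u, ψ u = w)
    (hker : ∀ u, R' *ᵥ ψ u = 0 ↔ ∀ i, u (Sum.inl i) = 0)
    {α : Type*} {l : Filter α} {r : α → ℝ} (hr : Tendsto r l atTop)
    {x : α → Fin k ⊕ Fin d → ℝ} {u : Fin k ⊕ Fin d → ℝ} (hx : Tendsto x l (𝓝 u))
    {q : α → A → ℝ} (hq : ∀ᶠ i in l, q i ∈ eqClass R f ∧ q i = p + (r i)⁻¹ • ψ (x i)) :
    Tendsto (fun i => 2 * r i ^ 2 * entropyGap R R' (q i)) l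
      (𝓝 (∑ i, u (Sum.inl i) ^ 2)) := by
  set K : α → ℝ := fun i => entropyGap R R' (q i) with hK
  set w : α → A → ℝ := fun i => maxEnt R' (q i) - p with hw
  have hr0 : ∀ᶠ i in l, 0 < r i := hr.eventually (eventually_gt_atTop 0)
  have hsum : Tendsto (fun i => ∑ j, x i (Sum.inl j) ^ 2) l (𝓝 (∑ j, u (Sum.inl j) ^ 2)) :=
    tendsto_finsetSum _ fun j _ => (tendsto_pi_nhds.1 hx (Sum.inl j)).pow 2
  have hclass : ∀ᶠ i in l, maxEnt R' (q i) ∈ eqClass R f := by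
    filter_upwards [hq] with i hi
    rw [← eqClass_eq_of_mem hi.1]
    exact eqClass_subset_of_implies hRR' (isMaxEnt_maxEnt R' hi.1.1).1
  have hKrel : ∀ᶠ i in l, K i = relEntropy p (p + w i) := by
    filter_upwards [hq, hclass] with i hi hci
    have h1 : maxEnt R (q i) = p := by rw [maxEnt_eq_of_mem hi.1, hp.eq_maxEnt hf]
    simp only [hK, hw]
    rw [entropyGap, h1, add_sub_cancel, hp.entropy_sub hpos hci]
  -- Dropping the coordinates along the kernel of R' keeps the R'-moments. The resulting point
  -- competes with the maximizer for R', which bounds the gap from above.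
  set y : α → Fin k ⊕ Fin d → ℝ := fun i => Sum.elim (fun j => x i (Sum.inl j)) 0 with hy
  have hyt : Tendsto y l (𝓝 (Sum.elim (fun j => u (Sum.inl j)) 0)) := by
    refine tendsto_pi_nhds.2 fun j => ?_
    rcases j with j | j
    · simpa [hy] using tendsto_pi_nhds.1 hx (Sum.inl j)
    · simpa [hy] using tendsto_const_nhds
  have hupper : Tendsto (fun i => 2 * r i ^ 2 * relEntropy p (p + (r i)⁻¹ • ψ (y i))) l
      (𝓝 (∑ j, u (Sum.inl j) ^ 2)) := by
    simpa [Fintype.sum_sum_type] using tendsto_relEntropy_coordinates hpos hψ hr hyt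
  have hle : ∀ᶠ i in l, 2 * r i ^ 2 * K i ≤
      2 * r i ^ 2 * relEntropy p (p + (r i)⁻¹ • ψ (y i)) := by
    have hnn : ∀ᶠ i in l, ∀ a, 0 ≤ p a + ((r i)⁻¹ • ψ (y i)) a := by
      refine eventually_all.2 fun a => ?_
      have h1 := (tendsto_pi_nhds.1 (tendsto_inv_smul ψ hr hyt) a).const_add (p a)
      rw [Pi.zero_apply, add_zero] at h1
      exact h1.eventually (le_mem_nhds (hpos a))
    filter_upwards [hq, hnn, hKrel, hclass] with i hi hni hKi hci
    have hmem : p + (r i)⁻¹ • ψ (y i) ∈ eqClass R f :=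
      add_mem_eqClass hR hp.1 (by rw [mulVec_smul, (hrange _).2 ⟨_, rfl⟩, smul_zero]) hni
    have hmem' : p + (r i)⁻¹ • ψ (y i) ∈ eqClass R' (q i) := by
      refine ⟨hmem.1, ?_⟩
      have h2 : R' *ᵥ ψ (y i - x i) = 0 := (hker _).2 fun j => by simp [hy]
      rw [map_sub, mulVec_sub, sub_eq_zero] at h2
      rw [hi.2, mulVec_add, mulVec_add, mulVec_smul, mulVec_smul, h2]
    have hmax : entropy (p + (r i)⁻¹ • ψ (y i)) ≤ entropy (maxEnt R' (q i)) :=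
      (isMaxEnt_maxEnt R' hi.1.1).2 hmem'
    have h3 : p + w i = maxEnt R' (q i) := by simp [hw]
    rw [hKi, h3, ← hp.entropy_sub hpos hmem, ← hp.entropy_sub hpos hci]
    gcongr
  -- The maximizer differs from q by an element of the kernel of R', so it has the same transversal
  -- coordinates, and the others only add to the quadratic form.
  have hlow : ∀ᶠ i in l, ∑ j, x i (Sum.inl j) ^ 2 ≤ r i ^ 2 * chiSq p (w i) := by
    filter_upwards [hq, hclass, hr0] with i hi hci hri
    obtain ⟨v, hv⟩ := (hrange (r i • w i)).1 (by
      simp only [hw]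
      rw [mulVec_smul, mulVec_sub, hci.2, hp.1.2, sub_self, smul_zero])
    have h1 : ψ (v - x i) = r i • (maxEnt R' (q i) - q i) := by
      have h4 : ψ (x i) = r i • (q i - p) := by
        rw [hi.2, add_sub_cancel_left, smul_inv_smul₀ hri.ne']
      rw [map_sub, hv, h4, ← smul_sub]
      simp [hw]
    have h2 := (hker (v - x i)).1 (by
      rw [h1, mulVec_smul, mulVec_sub, (isMaxEnt_maxEnt R' hi.1.1).1.2, sub_self, smul_zero])
    rw [← chiSq_smul, ← hv, hψ, Fintype.sum_sum_type]
    have h3 : ∀ j, x i (Sum.inl j) = v (Sum.inl j) := fun j =>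
      (sub_eq_zero.1 (h2 j)).symm
    simp only [h3]
    exact le_add_of_nonneg_right (Finset.sum_nonneg fun j _ => sq_nonneg _)
  obtain ⟨c, hc0, hc⟩ := exists_mul_chiSq_le_relEntropy hpos
  -- The upper bound on 2 r² K, eventually at most its limit plus 1, is divided by twice the
  -- coercivity constant. The resulting bound lets the quadratic approximation be applied at the
  -- maximizer itself.
  set M := (∑ j, u (Sum.inl j) ^ 2 + 1) / (2 * c) with hM
  have hbdd : ∀ᶠ i in l, r i ^ 2 * chiSq p (w i) ≤ M := by
    filter_upwards [hle, hupper.eventually (ge_mem_nhds (lt_add_one _)), hKrel, hclass]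
      with i h1 h2 h3 h4
    have h5 : c * chiSq p (w i) ≤ K i := by
      rw [h3]
      simpa [hw] using hc _ h4.1
    rw [hM, le_div_iff₀ (by positivity)]
    nlinarith [mul_le_mul_of_nonneg_left h5 (sq_nonneg (r i))]
  have hw0 : Tendsto w l (𝓝 0) := by
    refine tendsto_zero_of_chiSq hpos ?_
    have h1 : Tendsto (fun i => M / r i ^ 2) l (𝓝 0) :=
      tendsto_const_nhds.div_atTop ((tendsto_pow_atTop two_ne_zero).comp hr)
    refine squeeze_zero' (Eventually.of_forall fun i => chiSq_nonneg hpos _) ?_ h1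
    filter_upwards [hbdd, hr0] with i hi hri
    rw [le_div_iff₀ (by positivity)]
    linarith
  have hdiff := tendsto_mul_relEntropy_sub hpos hw0 (N := fun i => r i ^ 2)
    (Eventually.of_forall fun i => sq_nonneg _) hbdd
  have hlower := hsum.add hdiff
  rw [add_zero] at hlower
  refine tendsto_of_tendsto_of_tendsto_of_le_of_le' hlower hupper ?_ hle
  filter_upwards [hlow, hKrel] with i h1 h2
  change _ ≤ 2 * r i ^ 2 * K i
  rw [h2]
  linarith

end GapAsymptotics

/-! ### From datasets to Gaussian probabilities -/

section ClassAsymptotics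

variable {A : Type*} [Fintype A] {D D' : ℕ} {R : Matrix (Fin D) A ℝ} {R' : Matrix (Fin D') A ℝ}
  {f p : A → ℝ}

theorem mem_datasets {N : ℕ} {n : A → ℕ} :
    n ∈ datasets R f N ↔ ∑ a, n a = N ∧ empirical n ∈ eqClass R f := by
  classical
  simp [datasets, Finset.mem_piAntidiag]

theorem mul_empirical {N : ℕ} {n : A → ℕ} (hN : 0 < N) (hn : ∑ a, n a = N) (a : A) :
    (N : ℝ) * empirical n a = n a := by
  have : (N : ℝ) ≠ 0 := by positivity
  rw [empirical, hn]
  field_simp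

/-- The common factor exp (N H[p]) cancels between numerator and denominator, leaving weights
governed by the relative entropy. -/
theorem classProb_eq (hp : IsMaxEnt R f p) (hpos : ∀ a, 0 < p a) (N : ℕ) (E : (A → ℝ) → Prop)
    [DecidablePred E] :
    classProb R f N E =
      (∑ n ∈ datasets R f N, if E (empirical n) then exp (-N * relEntropy p (empirical n)) else 0) /
        ∑ n ∈ datasets R f N, exp (-N * relEntropy p (empirical n)) := by
  have h : ∀ n ∈ datasets R f N,
      exp (N * entropy (empirical n)) =
        exp (N * entropy p) * exp (-N * relEntropy p (empirical n)) := by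
    intro n hn
    rw [← hp.entropy_sub hpos (mem_datasets.1 hn).2, ← exp_add]
    ring_nf
  rw [classProb, Finset.sum_filter, Finset.sum_congr rfl h, ← Finset.mul_sum,
    ← mul_div_mul_left (∑ n ∈ datasets R f N, if E (empirical n) then _ else 0) _
      (exp_pos (N * entropy p)).ne']
  congr 1
  rw [Finset.mul_sum]
  refine Finset.sum_congr rfl fun n hn => ?_
  split_ifs
  · exact h n hn
  · simp

variable {ι : Type*} [Fintype ι] {ψ : (ι → ℝ) →ₗ[ℝ] (A → ℝ)} {φ : (A → ℝ) →ₗ[ℝ] (ι → ℝ)}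

theorem eq_add_inv_smul_of_mem {ι : Type*} {ψ : (ι → ℝ) →ₗ[ℝ] (A → ℝ)}
    {φ : (A → ℝ) →ₗ[ℝ] (ι → ℝ)} (hp : p ∈ eqClass R f) (hφ : ∀ u, φ (ψ u) = u)
    (hrange : ∀ w, R *ᵥ w = 0 ↔ ∃ u, ψ u = w) {q : A → ℝ} (hq : q ∈ eqClass R f) {r : ℝ}
    (hr : r ≠ 0) : q = p + r⁻¹ • ψ (φ (r • (q - p))) := by
  obtain ⟨u, hu⟩ := (hrange (r • (q - p))).1 (by
    rw [mulVec_smul, mulVec_sub, hq.2, hp.2, sub_self, smul_zero])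
  rw [← hu, hφ, hu, inv_smul_smul₀ hr, add_sub_cancel]

/-- The filter of the large sample sizes for which there are datasets in the class of `f`. -/
abbrev sampleSizes (R : Matrix (Fin D) A ℝ) (f : A → ℝ) : Filter ℕ :=
  atTop ⊓ 𝓟 {N : ℕ | (datasets R f N).Nonempty}

theorem tendsto_sqrt_sampleSizes (R : Matrix (Fin D) A ℝ) (f : A → ℝ) :
    Tendsto (fun N : ℕ => √(N : ℝ)) (sampleSizes R f) atTop :=
  (tendsto_sqrt_atTop.comp tendsto_natCast_atTop_atTop).mono_left inf_le_left

/-- The cells of the datasets exhaust the coordinate space. -/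
theorem eventually_exists_mem_cell (hR : IsArchitecture R) (hp : p ∈ eqClass R f)
    (hpos : ∀ a, 0 < p a) (hφ : ∀ u, φ (ψ u) = u)
    (hrange : ∀ w, R *ᵥ w = 0 ↔ ∃ u, ψ u = w) {m : ℕ}
    {b : Module.Basis (Fin m) ℝ (ι → ℝ)}
    (hb : ∀ u, u ∈ Submodule.span ℤ (Set.range b) ↔ ∃ z : A → ℤ, ψ u = fun a => (z a : ℝ))
    (u : ι → ℝ) :
    ∀ᶠ N : ℕ in sampleSizes R f, ∃ n ∈ datasets R f N,
      u ∈ cell b √(N : ℝ) (φ (√(N : ℝ) • (empirical n - p))) := by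
  have hr := tendsto_sqrt_sampleSizes R f
  obtain ⟨C, hC0, hC⟩ := exists_norm_sub_le_of_mem_cell b
  -- A base point whose cell contains u stays bounded, so its displacement from p is of order
  -- N^(-1/2) and eventually cannot leave the positive orthant.
  have hpos' : ∀ᶠ N : ℕ in sampleSizes R f, ∀ x, u ∈ cell b √(N : ℝ) x →
      ∀ a, 0 ≤ p a + ((√(N : ℝ))⁻¹ • ψ x) a := by
    obtain ⟨K, hK0, hK⟩ := (LinearMap.toContinuousLinearMap ψ).bound
    have h1 : ∀ᶠ N : ℕ in sampleSizes R f, ∀ a, (√(N : ℝ))⁻¹ * (K * (‖u‖ + C)) ≤ p a := by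
      refine eventually_all.2 fun a => ?_
      have h2 := (tendsto_inv_atTop_zero.comp hr).mul_const (K * (‖u‖ + C))
      rw [zero_mul] at h2
      exact h2.eventually (ge_mem_nhds (hpos a))
    filter_upwards [h1, hr.eventually (eventually_ge_atTop 1)] with N hN hN1 x hx a
    have hxu : ‖u - x‖ ≤ C := (hC _ (by linarith) _ _ hx).trans (div_le_self hC0.le hN1)
    have hxn : ‖x‖ ≤ ‖u‖ + C := by
      have := norm_sub_le u (u - x)
      rw [sub_sub_cancel] at this
      linarith
    have h3 : |ψ x a| ≤ K * (‖u‖ + C) :=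
      (norm_le_pi_norm (ψ x) a).trans ((hK x).trans (by gcongr))
    have h4 : (√(N : ℝ))⁻¹ * |ψ x a| ≤ p a := le_trans (by gcongr) (hN a)
    rw [Pi.smul_apply, smul_eq_mul]
    have h5 : -(√(N : ℝ))⁻¹ * |ψ x a| ≤ (√(N : ℝ))⁻¹ * ψ x a := by
      rw [neg_mul, ← mul_neg]
      gcongr
      exact neg_abs_le _
    linarith
  filter_upwards [hpos', hr.eventually (eventually_gt_atTop 0),
    eventually_inf_principal.2 (Eventually.of_forall fun N hN => hN)] with N hN hN0 hne
  obtain ⟨n₀, hn₀⟩ := hne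
  obtain ⟨hn₀sum, hn₀cl⟩ := mem_datasets.1 hn₀
  have hNpos : 0 < N := by exact_mod_cast sqrt_pos.1 hN0
  have hNne : (N : ℝ) ≠ 0 := by positivity
  have hss : √(N : ℝ) * √(N : ℝ) = N := mul_self_sqrt (Nat.cast_nonneg N)
  set x₀ := φ (√(N : ℝ) • (empirical n₀ - p)) with hx₀
  -- An existing dataset n₀ anchors the shifted lattice. A step v / √N in scaled coordinates changes
  -- the counts by exactly the integer vector z = ψ v.
  obtain ⟨v, hv, huv⟩ := exists_mem_cell b hN0 x₀ u
  obtain ⟨z, hz⟩ := (hb v).1 hv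
  set x := x₀ + (√(N : ℝ))⁻¹ • v with hx
  have hnn := hN x huv
  have hq : p + (√(N : ℝ))⁻¹ • ψ x ∈ eqClass R f :=
    add_mem_eqClass hR hp (by rw [mulVec_smul, (hrange _).2 ⟨_, rfl⟩, smul_zero]) hnn
  have hcount : ∀ a, (N : ℝ) * (p a + ((√(N : ℝ))⁻¹ • ψ x) a) = n₀ a + z a := by
    intro a
    have h1 := congrFun (eq_add_inv_smul_of_mem hp hφ hrange hn₀cl hN0.ne') a
    rw [← mul_empirical hNpos hn₀sum a, h1, hx, map_add, map_smul, hz, ← hx₀]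
    simp only [Pi.add_apply, Pi.smul_apply, smul_eq_mul]
    rw [mul_add (√(N : ℝ))⁻¹, ← add_assoc, mul_add _ (_ + _) ((√(N : ℝ))⁻¹ * _)]
    have h2 : (N : ℝ) * ((√(N : ℝ))⁻¹ * (√(N : ℝ))⁻¹) = 1 := by
      rw [← mul_inv, hss, mul_inv_cancel₀ hNne]
    linear_combination (z a : ℝ) * h2
  have hzn : ∀ a, (0 : ℤ) ≤ n₀ a + z a := by
    intro a
    have h1 : (0 : ℝ) ≤ n₀ a + z a := by
      rw [← hcount a]
      exact mul_nonneg (Nat.cast_nonneg N) (hnn a)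
    exact_mod_cast h1
  set n : A → ℕ := fun a => (n₀ a + z a).toNat with hn
  have hncast : ∀ a, (n a : ℝ) = N * (p a + ((√(N : ℝ))⁻¹ • ψ x) a) := by
    intro a
    rw [hcount a]
    have h1 : ((n a : ℤ) : ℝ) = ((n₀ a + z a : ℤ) : ℝ) := by rw [hn, Int.toNat_of_nonneg (hzn a)]
    exact_mod_cast h1
  have hnsum : ∑ a, n a = N := by
    have h1 : (∑ a, (n a : ℝ)) = N := by
      simp only [hncast, ← Finset.mul_sum]
      exact (congrArg _ hq.1.2).trans (mul_one _)
    exact_mod_cast h1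
  have hemp : empirical n = p + (√(N : ℝ))⁻¹ • ψ x := by
    funext a
    rw [empirical, hnsum, hncast, mul_div_cancel_left₀ _ hNne, Pi.add_apply]
  refine ⟨n, mem_datasets.2 ⟨hnsum, hemp ▸ hq⟩, ?_⟩
  rwa [hemp, add_sub_cancel_left, smul_inv_smul₀ hN0.ne', hφ]

open Classical in
/-- Asymptotics of the total weight of an event. -/
theorem tendsto_weight (hR : IsArchitecture R) (hp : IsMaxEnt R f p)
    (hpos : ∀ a, 0 < p a) (hψ : ∀ u, chiSq p (ψ u) = ∑ i, u i ^ 2) (hφ : ∀ u, φ (ψ u) = u)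
    (hrange : ∀ w, R *ᵥ w = 0 ↔ ∃ u, ψ u = w) {m : ℕ}
    {b : Module.Basis (Fin m) ℝ (ι → ℝ)}
    (hb : ∀ u, u ∈ Submodule.span ℤ (Set.range b) ↔ ∃ z : A → ℤ, ψ u = fun a => (z a : ℝ))
    {E : ℕ → (A → ℝ) → Prop} {B : Set (ι → ℝ)}
    (hE : ∀ᵐ u, ∀ n : ℕ → A → ℕ, (∀ᶠ N in sampleSizes R f, n N ∈ datasets R f N) →
      Tendsto (fun N : ℕ => φ (√(N : ℝ) • (empirical (n N) - p))) (sampleSizes R f) (𝓝 u) →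
      ∀ᶠ N in sampleSizes R f, (E N (empirical (n N)) ↔ u ∈ B)) :
    Tendsto (fun N : ℕ => volume.real (cell b √(N : ℝ) 0) * ∑ n ∈ datasets R f N,
        if E N (empirical n) then exp (-N * relEntropy p (empirical n)) else 0)
      (sampleSizes R f) (𝓝 (∫ u, B.indicator (fun u => exp (-(∑ i, u i ^ 2) / 2)) u)) := by
  have hr := tendsto_sqrt_sampleSizes R f
  have hr0 := hr.eventually (eventually_gt_atTop 0)
  have hNpos : ∀ N : ℕ, 0 < √(N : ℝ) → 0 < N := fun N h => by exact_mod_cast sqrt_pos.1 h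
  have hss : ∀ N : ℕ, √(N : ℝ) ^ 2 = N := fun N => sq_sqrt (Nat.cast_nonneg N)
  obtain ⟨c, hc0, hc⟩ := exists_mul_chiSq_le_relEntropy hpos
  refine tendsto_lattice_sum b (x := fun (N : ℕ) n => φ (√(N : ℝ) • (empirical n - p))) hr ?_ ?_
    (eventually_exists_mem_cell hR hp.1 hpos hφ hrange hb) hc0 ?_ ?_
  · filter_upwards [hr0] with N hN n hn n' hn' h
    obtain ⟨h1, h2⟩ := mem_datasets.1 hn
    obtain ⟨h1', h2'⟩ := mem_datasets.1 hn'
    have h3 : empirical n = empirical n' := by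
      rw [eq_add_inv_smul_of_mem hp.1 hφ hrange h2 hN.ne',
        eq_add_inv_smul_of_mem hp.1 hφ hrange h2' hN.ne']
      exact congrArg (fun x => p + (√(N : ℝ))⁻¹ • ψ x) h
    funext a
    have h4 : (n a : ℝ) = n' a := by
      rw [← mul_empirical (hNpos N hN) h1, ← mul_empirical (hNpos N hN) h1', h3]
    exact_mod_cast h4
  · filter_upwards [hr0] with N hN n hn n' hn'
    obtain ⟨h1, h2⟩ := mem_datasets.1 hn
    obtain ⟨h1', h2'⟩ := mem_datasets.1 hn'
    obtain ⟨v, hv⟩ := (hrange (empirical n - empirical n')).1 (by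
      rw [mulVec_sub, h2.2, h2'.2, sub_self])
    have h3 : φ (√(N : ℝ) • (empirical n - p)) - φ (√(N : ℝ) • (empirical n' - p)) =
        √(N : ℝ) • v := by
      rw [← map_sub, ← smul_sub, sub_sub_sub_cancel_right, ← hv, map_smul, hφ]
    -- One factor √N comes from the scaled coordinates and one from the mesh; together they turn
    -- frequencies into integer counts.
    rw [h3, smul_smul, ← sq, hss, hb]
    refine ⟨fun a => n a - n' a, ?_⟩
    funext a
    rw [map_smul, hv, Pi.smul_apply, smul_eq_mul, Pi.sub_apply, mul_sub,
      mul_empirical (hNpos N hN) h1, mul_empirical (hNpos N hN) h1']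
    push_cast
    rfl
  · filter_upwards [hr0] with N hN n hn
    obtain ⟨h1, h2⟩ := mem_datasets.1 hn
    have h3 : exp (-N * relEntropy p (empirical n)) ≤
        exp (-c * ∑ j, φ (√(N : ℝ) • (empirical n - p)) j ^ 2) := by
      refine exp_le_exp.2 ?_
      have h4 := hc _ h2.1
      have h5 : (N : ℝ) * chiSq p (empirical n - p) =
          ∑ j, φ (√(N : ℝ) • (empirical n - p)) j ^ 2 := by
        rw [← sq_mul_chiSq_inv_smul hψ hN.ne', hss]
        nth_rewrite 1 [eq_add_inv_smul_of_mem hp.1 hφ hrange h2 hN.ne']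
        rw [add_sub_cancel_left]
      rw [← h5]
      nlinarith [mul_le_mul_of_nonneg_left h4 (Nat.cast_nonneg (α := ℝ) N)]
    split_ifs
    · rwa [abs_of_pos (exp_pos _)]
    · rw [abs_zero]
      positivity
  · filter_upwards [hE] with u hu n hn hx
    have h1 : Tendsto (fun N : ℕ => exp (-N * relEntropy p (empirical (n N)))) (sampleSizes R f)
        (𝓝 (exp (-(∑ i, u i ^ 2) / 2))) := by
      have h2 := (tendsto_relEntropy_coordinates hpos hψ hr hx).const_mul (-1 / 2)
      rw [show -1 / 2 * ∑ i, u i ^ 2 = -(∑ i, u i ^ 2) / 2 by ring] at h2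
      refine (continuous_exp.tendsto _).comp (h2.congr' ?_)
      filter_upwards [hn, hr0] with N hN hN0
      rw [← eq_add_inv_smul_of_mem hp.1 hφ hrange (mem_datasets.1 hN).2 hN0.ne', hss]
      ring
    by_cases huB : u ∈ B
    · rw [indicator_of_mem huB]
      refine h1.congr' ?_
      filter_upwards [hu n hn hx] with N hN
      rw [if_pos (hN.2 huB)]
    · rw [indicator_of_notMem huB]
      refine tendsto_const_nhds.congr' ?_
      filter_upwards [hu n hn hx] with N hN
      rw [if_neg fun h => huB (hN.1 h)]

theorem tendsto_classProb_rejected (hR : IsArchitecture R) (hR' : IsArchitecture R')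
    (hRR' : Implies R' R) (hD : D < D') (hker : HasIntegralKernel R) (hf : f ∈ stdSimplex ℝ A)
    (hpos : ∀ a, ∃ q ∈ eqClass R f, 0 < q a) {s : ℝ} (hs : s ∈ Ioo (0 : ℝ) 1) :
    Tendsto (fun N : ℕ => classProb R f N (Rejected R R' s N)) (sampleSizes R f) (𝓝 s) := by
  classical
  have hp := isMaxEnt_maxEnt R hf
  set p := maxEnt R f
  have hppos : ∀ a, 0 < p a := fun a => by
    obtain ⟨q, hq, hqa⟩ := hpos a
    exact hp.pos hq hqa
  obtain ⟨d, ψ, hψ, hrange, hψker⟩ := exists_model_coordinates hR hR' hRR' hD.le hppos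
  have hinj : LinearMap.ker ψ = ⊥ := by
    refine LinearMap.ker_eq_bot'.2 fun u hu => ?_
    have h := hψ u
    rw [hu] at h
    have h1 : ∑ i, u i ^ 2 = 0 := by rw [← h]; simp [chiSq]
    funext i
    simpa using (Finset.sum_eq_zero_iff_of_nonneg fun i _ => sq_nonneg (u i)).1 h1 i
      (Finset.mem_univ i)
  obtain ⟨φ, hφ'⟩ := ψ.exists_leftInverse_of_injective hinj
  have hφ : ∀ u, φ (ψ u) = u := fun u => LinearMap.congr_fun hφ' u
  obtain ⟨m, b, hb⟩ := exists_integral_basis hker (LinearMap.ker_eq_bot.1 hinj) hrange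
  have hk : 0 < D' - D := by omega
  have := nullSingletonClass_chiSquared hk
  -- A p-value below s means a distribution function above 1 - s, that is, a statistic above the
  -- quantile c.
  obtain ⟨c, hc, hcs⟩ := exists_quantile (chiSquared (D' - D)) (u := 1 - s)
    ⟨by linarith [hs.2], by linarith [hs.1]⟩
  have hr := tendsto_sqrt_sampleSizes R f
  have hr0 := hr.eventually (eventually_gt_atTop 0)
  set B : Set (Fin (D' - D) ⊕ Fin d → ℝ) := {u | ∑ i, u (Sum.inl i) ^ 2 ∈ Ioi c} with hB
  have hBmeas : MeasurableSet B := by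
    have : Measurable fun u : Fin (D' - D) ⊕ Fin d → ℝ => ∑ i, u (Sum.inl i) ^ 2 := by fun_prop
    exact this measurableSet_Ioi
  have hnum := tendsto_weight hR hp hppos hψ hφ hrange hb (E := Rejected R R' s) (B := B) (by
    filter_upwards [ae_sum_sq_inl_ne hk c] with u hu n hn hx
    have hgap := tendsto_entropyGap hR hRR' hp hppos hf hψ hrange hψker hr hx
      (q := fun N => empirical (n N)) (by
        filter_upwards [hn, hr0] with N hN hN0
        exact ⟨(mem_datasets.1 hN).2,
          eq_add_inv_smul_of_mem hp.1 hφ hrange (mem_datasets.1 hN).2 hN0.ne'⟩)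
    simp only [sq_sqrt (Nat.cast_nonneg _)] at hgap
    have hrej : ∀ N q, Rejected R R' s N q ↔ c < 2 * N * entropyGap R R' q := fun N q => by
      rw [← hc, Rejected, sub_lt_comm]
    simp only [hrej]
    rcases lt_or_gt_of_ne hu with h | h
    · filter_upwards [hgap.eventually (gt_mem_nhds h)] with N hN
      exact iff_of_false hN.not_gt h.not_gt
    · filter_upwards [hgap.eventually (lt_mem_nhds h)] with N hN
      exact iff_of_true hN h)
  -- The sure event gives the normalizing sum, with the same cell volume as in the numerator.
  have hden := tendsto_weight hR hp hppos hψ hφ hrange hb (E := fun _ _ => True) (B := univ)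
    (ae_of_all _ fun u n _ _ => Eventually.of_forall fun N => by simp)
  simp only [if_true, indicator_univ] at hden
  have hI : (∫ u : Fin (D' - D) ⊕ Fin d → ℝ, exp (-(∑ i, u i ^ 2) / 2)) ≠ 0 := by
    intro h0
    have h := integral_indicator_exp_div (ι := Fin (D' - D) ⊕ Fin d) MeasurableSet.univ
    rw [h0, div_zero, probReal_univ] at h
    exact zero_ne_one h
  have hlim := hnum.div hden hI
  rw [integral_indicator_exp_div hBmeas, measureReal_def,
    pi_gaussianReal_sum_sq_inl _ measurableSet_Ioi, ← measureReal_def, hcs, sub_sub_cancel] at hlim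
  refine hlim.congr' ?_
  filter_upwards [hr0] with N hN
  rw [classProb_eq hp hppos, Pi.div_apply, mul_div_mul_left _ _ (volume_real_cell_pos b hN 0).ne']

end ClassAsymptotics

end MaxEntLRT

theorem mainTheorem3 {A : Type*} [Fintype A] {D D' : ℕ}
    (R : Matrix (Fin D) A ℝ) (R' : Matrix (Fin D') A ℝ)
    (hR : MaxEntLRT.IsArchitecture R) (hR' : MaxEntLRT.IsArchitecture R')
    (hRR' : MaxEntLRT.Implies R' R) :
    -- the log-likelihood ratio of every dataset
    (∀ n : A → ℕ, 0 < ∑ a, n a →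
      0 < MaxEntLRT.mult n (MaxEntLRT.maxEnt R (MaxEntLRT.empirical n)) ∧
      0 < MaxEntLRT.mult n (MaxEntLRT.maxEnt R' (MaxEntLRT.empirical n)) ∧
      Real.log (MaxEntLRT.mult n (MaxEntLRT.maxEnt R' (MaxEntLRT.empirical n)) /
          MaxEntLRT.mult n (MaxEntLRT.maxEnt R (MaxEntLRT.empirical n))) =
        ((∑ a, n a : ℕ) : ℝ) * MaxEntLRT.entropyGap R R' (MaxEntLRT.empirical n)) ∧
    -- the rejection rule has asymptotic significance level `s`
    (D < D' → MaxEntLRT.HasIntegralKernel R →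
      ∀ n : A → ℕ, 0 < ∑ a, n a →
      (∀ a, ∃ p ∈ MaxEntLRT.eqClass R (MaxEntLRT.empirical n), 0 < p a) →
      ∀ s ∈ Set.Ioo (0 : ℝ) 1,
        Tendsto
          (fun N : ℕ => MaxEntLRT.classProb R (MaxEntLRT.empirical n) N
            (MaxEntLRT.Rejected R R' s N))
          (atTop ⊓ 𝓟 {N : ℕ | (MaxEntLRT.datasets R (MaxEntLRT.empirical n) N).Nonempty})
          (𝓝 s)) := by
  refine ⟨fun n hn => ⟨?_, ?_, MaxEntLRT.log_likelihood_ratio hn R R'⟩,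
    fun hD hker n hn hpos s hs => ?_⟩
  · exact MaxEntLRT.mult_pos (MaxEntLRT.maxEnt_empirical_pos hn R)
  · exact MaxEntLRT.mult_pos (MaxEntLRT.maxEnt_empirical_pos hn R')
  · exact MaxEntLRT.tendsto_classProb_rejected hR hR' hRR' hD hker
      (MaxEntLRT.empirical_mem_stdSimplex hn) hpos hs
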